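/- Let $p>2$ be a prime, let $K$ be the completion of the maximal unramified extension of $\mathbb{Q}_p$, with ring of integers $\mathcal{O}_K=W(\overline{\mathbb{F}}_p)$, let $\overline{K}$ be an algebraic closure of $K$, let $\mathcal{O}$ be the integral closure of $\mathcal{O}_K$ in $\overline{K}$, and let $\mathfrak{m}$ be the maximal ideal of $\mathcal{O}$. Let $d\colon\mathcal{O}\to\Omega^1_{\mathcal{O}/\mathcal{O}_K}$ be the universal derivation into the module of Kähler differentials, and put $\mathcal{O}^{(1)}=\ker(d)$. Let $\mathscr{F}$ be a commutative formal group (law) of dimension $g$ over $\mathcal{O}_K$, and let $[p](X_1,\dots,X_g)=(f_1,\dots,f_g)$, with $f_i\in\mathcal{O}_K[[X_1,\dots,X_g]]$, be its multiplication-by-$p$ map. For each $i$, let $F_i$ be the form consisting of those monomials of $f_i$ that have minimal total degree among the monomials of $f_i$ with unit coefficient and themselves have a unit coefficient; let $d_i$ be its degree, and let $G_i\in\overline{\mathbb{F}}_p[X_1,\dots,X_g]$ be the reduction of $F_i$ modulo $p$ (if $f_i$ has no monomial with unit coefficient, put $F_i=0$ and $d_i=0$). One says that $\mathscr{F}$ is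 strict if $d_1=\dots=d_g$ and the only common zero of $G_1,\dots,G_g$ in $(\overline{\mathbb{F}}_p)^g$ is $(0,\dots,0)$. Let $\mathscr{F}[p](\mathcal{O})$ be the set of $P=(x_1,\dots,x_g)\in\mathfrak{m}^g$ with $f_1(P)=\dots=f_g(P)=0$, where the power series are evaluated as $p$-adically convergent sums. If $\mathscr{F}$ is strict, then for every $P=(x_1,\dots,x_g)\in\mathscr{F}[p](\mathcal{O})$ with $P\neq 0$ the coordinates of $P$ are not all in $\mathcal{O}^{(1)}$, i.e. there is an index $i$ with $x_i\notin\mathcal{O}^{(1)}$. -/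

import Mathlib

noncomputable section

open MvPowerSeries
open scoped KaehlerDifferential

/-! ## Formal group laws in several variables -/

/-- A (commutative) formal group law of dimension `g` over `R`: a `g`-tuple of power series
`F(X, Y)` in two sets of `g` variables with `F(X, 0) = X`, `F(0, Y) = Y`,
`F(F(X, Y), Z) = F(X, F(Y, Z))` and `F(Y, X) = F(X, Y)`. The left summand of the index type
holds the variables `X`, the right one the variables `Y`. -/
structure FormalGroupLaw (R : Type*) [CommRing R] (g : ℕ) where
  /-- The `g` power series of the law. -/
  law : Fin g → MvPowerSeries (Fin g ⊕ Fin g) R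
  law_zero : ∀ i, subst (Sum.elim X 0 : Fin g ⊕ Fin g → MvPowerSeries (Fin g) R) (law i) = X i
  zero_law : ∀ i, subst (Sum.elim 0 X : Fin g ⊕ Fin g → MvPowerSeries (Fin g) R) (law i) = X i
  assoc : ∀ i,
    subst (Sum.elim
        (fun j => subst (Sum.elim (fun k => X (Sum.inl k)) (fun k => X (Sum.inr (Sum.inl k)))) (law j))
        (fun k => X (Sum.inr (Sum.inr k))) :
          Fin g ⊕ Fin g → MvPowerSeries (Fin g ⊕ (Fin g ⊕ Fin g)) R) (law i) =
    subst (Sum.elim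
        (fun k => X (Sum.inl k))
        (fun j => subst (Sum.elim (fun k => X (Sum.inr (Sum.inl k)))
          (fun k => X (Sum.inr (Sum.inr k)))) (law j)) :
          Fin g ⊕ Fin g → MvPowerSeries (Fin g ⊕ (Fin g ⊕ Fin g)) R) (law i)
  comm : ∀ i,
    subst (Sum.elim (fun k => X (Sum.inr k)) (fun k => X (Sum.inl k)) :
      Fin g ⊕ Fin g → MvPowerSeries (Fin g ⊕ Fin g) R) (law i) = law i

/-- The multiplication-by-`n` series `[n](X) = (f₁(X), …, f_g(X))` of a formal group law:
`[0](X) = 0` and `[n + 1](X) = F([n](X), X)`. -/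
def FormalGroupLaw.mulBy {R : Type*} [CommRing R] {g : ℕ} (F : FormalGroupLaw R g) :
    ℕ → Fin g → MvPowerSeries (Fin g) R
  | 0 => 0
  | n + 1 => fun i => subst (Sum.elim (F.mulBy n) X) (F.law i)

/-! ## Monomials with unit coefficient, and strictness -/

/-- The minimal total degree of the monomials of `f` that have a unit coefficient
(and `0` if there is no such monomial). -/
def unitDegree {R : Type*} [CommRing R] {g : ℕ} (f : MvPowerSeries (Fin g) R) : ℕ :=
  sInf {d | ∃ m : Fin g →₀ ℕ, m.degree = d ∧ IsUnit (coeff m f)}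

open Classical in
/-- The form made up of the monomials of `f` with unit coefficient and minimal degree
(it is `0` if there is no such monomial). -/
def unitForm {R : Type*} [CommRing R] {g : ℕ} (f : MvPowerSeries (Fin g) R) :
    MvPolynomial (Fin g) R :=
  ∑ m ∈ (Finset.univ.finsuppAntidiag (unitDegree f)).filter (fun m => IsUnit (coeff m f)),
    MvPolynomial.monomial m (coeff m f)

/-! ## The fields and rings -/

/-- The algebraic closure of the field with `p` elements. -/
abbrev FpBar (p : ℕ) [Fact p.Prime] : Type := AlgebraicClosure (ZMod p)

/-- The ring of integers `O_K` of the completion `K` of the maximal unramified extension of the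
`p`-adic numbers, that is, the ring of `p`-typical Witt vectors of `FpBar p`. -/
abbrev OK (p : ℕ) [Fact p.Prime] : Type := WittVector p (FpBar p)

/-- The completion `K` of the maximal unramified extension of the `p`-adic numbers. -/
abbrev KField (p : ℕ) [Fact p.Prime] : Type := FractionRing (OK p)

/-- An algebraic closure of `K`. -/
abbrev KBar (p : ℕ) [Fact p.Prime] : Type := AlgebraicClosure (KField p)

/-- The ring of integers `O` of the algebraic closure of `K`: the integral closure of `O_K`. -/
abbrev OBar (p : ℕ) [Fact p.Prime] : Subalgebra (OK p) (KBar p) :=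
  integralClosure (OK p) (KBar p)

/-- `O^(1)`, the kernel of the universal derivation `d : O → Ω[O⁄O_K]`. -/
def OOne (p : ℕ) [Fact p.Prime] : Submodule (OK p) (OBar p) :=
  LinearMap.ker (KaehlerDifferential.D (OK p) (OBar p)).toLinearMap

/-- A formal group over `O_K` is strict if the forms `F₁, …, F_g` of monomials of minimal degree
with unit coefficient in the components of `[p]` all have the same degree, and their reductions
modulo `p` (along `O_K → O_K / p = FpBar p`) have no common zero but `0` over `FpBar p`. -/
def FormalGroupLaw.IsStrict {p : ℕ} [Fact p.Prime] {g : ℕ} (F : FormalGroupLaw (OK p) g) : Prop :=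
  (∀ i j, unitDegree (F.mulBy p i) = unitDegree (F.mulBy p j)) ∧
  ∀ a : Fin g → FpBar p,
    (∀ i, MvPolynomial.eval a
      (MvPolynomial.map (WittVector.constantCoeff : OK p →+* FpBar p)
        (unitForm (F.mulBy p i))) = 0) → a = 0

/-! ## Torsion points -/

/-- The power series `f`, evaluated at `x`, converges to `y` in the `p`-adic topology of `A`:
for every `N`, all sufficiently large finite partial sums are congruent to `y` modulo `p ^ N`. -/
def HasPadicValue (p : ℕ) {R A : Type*} [CommRing R] [CommRing A] [Algebra R A] {g : ℕ}
    (f : MvPowerSeries (Fin g) R) (x : Fin g → A) (y : A) : Prop :=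
  ∀ N : ℕ, ∃ s : Finset (Fin g →₀ ℕ), ∀ t : Finset (Fin g →₀ ℕ), s ⊆ t →
    (p : A) ^ N ∣ (∑ m ∈ t, algebraMap R A (coeff m f) * ∏ i, x i ^ m i) - y

/-- The set `F[n](O)` of `n`-torsion points of the formal group `F` with values in `O`: the tuples
of elements of the maximal ideal of `O` (the set of non-units of the local ring `O`) that are
annihilated by `[n]`. The neutral element is the zero tuple. -/
def FormalGroupLaw.torsion {p : ℕ} [Fact p.Prime] {g : ℕ} (F : FormalGroupLaw (OK p) g) (n : ℕ) :
    Set (Fin g → OBar p) :=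
  {P | (∀ i, P i ∈ nonunits (OBar p)) ∧ ∀ i, HasPadicValue p (F.mulBy n i) P 0}

end

/-! The Jacobian of `[p]` carries invariant vector fields to `p` times invariant vector fields, and
these form an invertible matrix. So every partial derivative of every `f_i` is divisible by `p`
(`dvd_pderiv_mulBy`), monomials with unit coefficient have exponents divisible by `p`, and
strictness forces the common degree `d` to be at least `p ≥ 3`.

Suppose `dx_j = 0` for all `j`. Finitely many relations witness this, so it already holds in the
ring of integers `B` of a finite extension of `K` containing all `x_j`. The residue field is
algebraically closed, so `B = O_K[π]` is totally ramified, and the minimal polynomial satisfies `E ≡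
X^e` mod `p`. Write `x_j = h_j(π)`; then `E'(π)` divides `h_j'(π)`. From `f(x) = 0` one gets `f(h) =
E q`. Differentiating and evaluating at `π` gives `E'(π) q(π) = ∑ ∂_j f(x) h_j'(π)`, which is
divisible by `p E'(π)`. Hence `p ∣ q(π)`, so `q` is a multiple of `E` mod `p`, and `X^(2e)` divides
`f(h)` mod `p` (`X_pow_two_mul_dvd`).

Let `m` be the least `π`-adic valuation of the `x_j`, and write `h_j ≡ X^m u_j` mod `p`. The linear
term `p x_i` must be balanced by other terms, whence `m(d-1) ≤ e` (`mul_sub_one_le`) and, as `d ≥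
3`, `md < 2e`. So the coefficient of `X^(md)` in `f_i(h)` mod `p`, which is `G_i(u(0))`, vanishes.
Strictness gives `u(0) = 0`, against the minimality of `m` (`eq_zero_of_isStrictTruncation`).

Power series enter only through truncations vanishing at `x` modulo `p^N`; an error `p^(M+1)` with
`E'(π) ∣ p^M` is harmless. -/

noncomputable section

/-! ### Chain rule for power series, and the Jacobian of multiplication by `n`. -/

section

open MvPowerSeries

namespace MvPowerSeries

open scoped WithPiTopology in
theorem continuous_pderiv {σ R : Type*} [CommRing R] [TopologicalSpace R] [IsTopologicalRing R]
    (i : σ) : Continuous (pderiv R i : MvPowerSeries σ R → MvPowerSeries σ R) := by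
  refine continuous_pi fun d => ?_
  have : (fun f : MvPowerSeries σ R => pderiv R i f d) =
      fun f => coeff (d + Finsupp.single i 1) f * ((d i : R) + 1) := by
    ext f
    exact coeff_pderiv f d
  rw [this]
  exact (WithPiTopology.continuous_coeff R _).mul continuous_const

open scoped WithPiTopology in
/-- The chain rule for substitution of power series. -/
theorem pderiv_subst {σ τ R : Type*} [Fintype σ] [CommRing R] {a : σ → MvPowerSeries τ R}
    (ha : HasSubst a) (f : MvPowerSeries σ R) (j : τ) :
    pderiv R j (subst a f) = ∑ i, subst a (pderiv R i f) * pderiv R j (a i) := by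
  -- For discrete `R`, polynomials are dense in the power series and both sides are continuous in
  -- `f`, so the identity need only be checked on polynomials.
  let : UniformSpace R := ⊥
  have : DiscreteUniformity R := ⟨rfl⟩
  have hs := continuous_subst (R := R) (S := R) ha
  have h1 : Continuous fun f : MvPowerSeries σ R => pderiv R j (subst a f) :=
    (continuous_pderiv j).comp hs
  have h2 : Continuous fun f : MvPowerSeries σ R =>
      ∑ i, subst a (pderiv R i f) * pderiv R j (a i) :=
    continuous_finsetSum _ fun i _ => (hs.comp (continuous_pderiv i)).mul continuous_const
  refine congrFun (WithPiTopology.denseRange_toMvPowerSeries.equalizer h1 h2 ?_) f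
  classical
  funext q
  simp only [Function.comp_apply, pderiv_coe, subst_coe]
  induction q using MvPolynomial.induction_on with
  | C r =>
    have : (algebraMap R (MvPowerSeries τ R)) r = C r := rfl
    simp [this]
  | add q q' hq hq' => simp [hq, hq', add_mul, Finset.sum_add_distrib]
  | mul_X q i hq =>
    simp only [map_mul, MvPolynomial.aeval_X, Derivation.leibniz, hq, smul_eq_mul,
      MvPolynomial.pderiv_X, map_add, add_mul, Finset.sum_add_distrib, Finset.mul_sum]
    congr 1
    · rw [Finset.sum_eq_single i]
      · simp
      · intro b _ hb
        simp [Pi.single_eq_of_ne hb.symm]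
      · simp
    · exact Finset.sum_congr rfl fun _ _ => by ring

theorem constantCoeff_subst_of_zero {σ τ R : Type*} [CommRing R]
    {a : σ → MvPowerSeries τ R} (ha : HasSubst a) (ha' : ∀ i, (a i).constantCoeff = 0)
    (f : MvPowerSeries σ R) : constantCoeff (subst a f) = constantCoeff f := by
  have h : f = (f - C (constantCoeff f)) + C (constantCoeff f) := by ring
  have hc : subst a (C (σ := σ) (constantCoeff f)) = C (constantCoeff f) := subst_C _
  conv_lhs => rw [h, subst_add ha, map_add, hc, constantCoeff_C]
  rw [constantCoeff_subst_eq_zero ha ha' (by simp), zero_add]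

end MvPowerSeries

namespace FormalGroupLaw

variable {R : Type*} [CommRing R] {g : ℕ} (F : FormalGroupLaw R g)

theorem constantCoeff_law (i : Fin g) : constantCoeff (F.law i) = 0 := by
  have hs : HasSubst (Sum.elim X 0 : Fin g ⊕ Fin g → MvPowerSeries (Fin g) R) :=
    hasSubst_of_constantCoeff_zero (by rintro (k | k) <;> simp)
  rw [← constantCoeff_subst_of_zero hs (by rintro (k | k) <;> simp), F.law_zero]
  simp

/-- The matrix of partial derivatives, along the first argument at `0`, of the group law: it
describes the invariant vector fields. -/
def invariantMatrix : Matrix (Fin g) (Fin g) (MvPowerSeries (Fin g) R) :=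
  fun i k => subst (Sum.elim 0 X : Fin g ⊕ Fin g → MvPowerSeries (Fin g) R)
    (pderiv R (Sum.inl k) (F.law i))

theorem hasSubst_sumElim {τ : Type*} {a b : Fin g → MvPowerSeries τ R}
    (ha : ∀ i, constantCoeff (a i) = 0) (hb : ∀ i, constantCoeff (b i) = 0) :
    HasSubst (Sum.elim a b) :=
  hasSubst_of_constantCoeff_zero (by rintro (k | k) <;> simp [ha, hb])

theorem pderiv_subst_sumElim {τ : Type*} {a b : Fin g → MvPowerSeries τ R}
    (ha : ∀ i, constantCoeff (a i) = 0) (hb : ∀ i, constantCoeff (b i) = 0)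
    (f : MvPowerSeries (Fin g ⊕ Fin g) R) (j : τ) :
    pderiv R j (subst (Sum.elim a b) f) =
      ∑ i, subst (Sum.elim a b) (pderiv R (Sum.inl i) f) * pderiv R j (a i) +
      ∑ i, subst (Sum.elim a b) (pderiv R (Sum.inr i) f) * pderiv R j (b i) := by
  rw [pderiv_subst (hasSubst_sumElim ha hb), Fintype.sum_sum_type]
  rfl

theorem subst_sumElim {τ υ : Type*} {a b : Fin g → MvPowerSeries τ R}
    (ha : ∀ i, constantCoeff (a i) = 0) (hb : ∀ i, constantCoeff (b i) = 0)
    {c : τ → MvPowerSeries υ R} (hc : HasSubst c)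
    (f : MvPowerSeries (Fin g ⊕ Fin g) R) :
    subst c (subst (Sum.elim a b) f) =
      subst (Sum.elim (fun i => subst c (a i)) (fun i => subst c (b i))) f := by
  rw [subst_comp_subst_apply (hasSubst_sumElim ha hb) hc]
  congr 1
  funext i
  rcases i with i | i <;> rfl

theorem constantCoeff_subst_law {τ : Type*} {a b : Fin g → MvPowerSeries τ R}
    (ha : ∀ i, constantCoeff (a i) = 0) (hb : ∀ i, constantCoeff (b i) = 0) (i : Fin g) :
    constantCoeff (subst (Sum.elim a b) (F.law i)) = 0 := by
  rw [constantCoeff_subst_of_zero (hasSubst_sumElim ha hb)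
    (by rintro (k | k) <;> simp [ha, hb]), F.constantCoeff_law]

/-- Invariance, in its universal form. -/
theorem sum_pderiv_inl_mul_invariantMatrix_universal (i k : Fin g) :
    ∑ j, pderiv R (Sum.inl j) (F.law i) *
        subst (fun l => X (Sum.inl l) : Fin g → MvPowerSeries (Fin g ⊕ Fin g) R)
          (F.invariantMatrix j k) =
      subst F.law (F.invariantMatrix i k) := by
  -- Differentiate associativity in a variable of the first block, then put that block equal to
  -- zero: the first argument becomes infinitesimal and the identity says that the field is
  -- invariant.
  have h := congrArg (pderiv R (Sum.inl k)) (F.assoc i)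
  have h1 : ∀ j, constantCoeff (subst (Sum.elim (fun k => X (Sum.inl k))
      (fun k => X (Sum.inr (Sum.inl k)))) (F.law j) :
        MvPowerSeries (Fin g ⊕ (Fin g ⊕ Fin g)) R) = 0 :=
    F.constantCoeff_subst_law (by simp) (by simp)
  have h2 : ∀ j, constantCoeff (subst (Sum.elim (fun k => X (Sum.inr (Sum.inl k)))
      (fun k => X (Sum.inr (Sum.inr k)))) (F.law j) :
        MvPowerSeries (Fin g ⊕ (Fin g ⊕ Fin g)) R) = 0 :=
    F.constantCoeff_subst_law (by simp) (by simp)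
  rw [pderiv_subst_sumElim h1 (by simp), pderiv_subst_sumElim (by simp) h2] at h
  have e1 : ∀ j, pderiv R (Sum.inl k) (X (Sum.inr (Sum.inr j)) :
      MvPowerSeries (Fin g ⊕ (Fin g ⊕ Fin g)) R) = 0 := fun j => pderiv_X_of_ne (by simp)
  have e2 : ∀ j, pderiv R (Sum.inl k) (X (Sum.inr (Sum.inl j)) :
      MvPowerSeries (Fin g ⊕ (Fin g ⊕ Fin g)) R) = 0 := fun j => pderiv_X_of_ne (by simp)
  have e3 : ∀ j, pderiv R (Sum.inl k) (X (Sum.inl j) :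
      MvPowerSeries (Fin g ⊕ (Fin g ⊕ Fin g)) R) = if j = k then 1 else 0 := fun j => by
    split_ifs with hj
    · rw [hj, pderiv_X_self]
    · exact pderiv_X_of_ne (by simpa using hj)
  have e4 : ∀ j, pderiv R (Sum.inl k) (subst (Sum.elim (fun k => X (Sum.inr (Sum.inl k)))
      (fun k => X (Sum.inr (Sum.inr k)))) (F.law j) :
        MvPowerSeries (Fin g ⊕ (Fin g ⊕ Fin g)) R) = 0 := fun j => by
    rw [pderiv_subst_sumElim (by simp) (by simp)]
    simp [e1, e2]
  have e5 : ∀ j, pderiv R (Sum.inl k) (subst (Sum.elim (fun k => X (Sum.inl k))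
      (fun k => X (Sum.inr (Sum.inl k)))) (F.law j) :
        MvPowerSeries (Fin g ⊕ (Fin g ⊕ Fin g)) R) =
      subst (Sum.elim (fun k => X (Sum.inl k)) (fun k => X (Sum.inr (Sum.inl k))))
        (pderiv R (Sum.inl k) (F.law j)) := fun j => by
    rw [pderiv_subst_sumElim (by simp) (by simp)]
    simp [e3, e2]
  simp only [e1, e3, e4, e5, mul_zero, Finset.sum_const_zero, add_zero, mul_ite, mul_one,
    Finset.sum_ite_eq', Finset.mem_univ, if_true] at h
  have hc : HasSubst (Sum.elim 0 X :
      Fin g ⊕ (Fin g ⊕ Fin g) → MvPowerSeries (Fin g ⊕ Fin g) R) :=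
    hasSubst_of_constantCoeff_zero (by rintro (k | k) <;> simp)
  have h' := congrArg (subst (Sum.elim 0 X :
      Fin g ⊕ (Fin g ⊕ Fin g) → MvPowerSeries (Fin g ⊕ Fin g) R)) h
  rw [← coe_substAlgHom hc, map_sum] at h'
  simp only [map_mul, coe_substAlgHom hc] at h'
  rw [subst_sumElim (by simp) h2 hc] at h'
  have hX1 : HasSubst (fun l => X (Sum.inl l) : Fin g → MvPowerSeries (Fin g ⊕ Fin g) R) :=
    hasSubst_of_constantCoeff_zero (by simp)
  have hL : HasSubst F.law := hasSubst_of_constantCoeff_zero F.constantCoeff_law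
  have s1 : ∀ f : MvPowerSeries (Fin g ⊕ Fin g) R,
      subst (Sum.elim (fun i => X (Sum.inl i)) fun i => X (Sum.inr i)) f = f := fun f => by
    have : (Sum.elim (fun i => X (Sum.inl i)) fun i => X (Sum.inr i) :
      Fin g ⊕ Fin g → MvPowerSeries (Fin g ⊕ Fin g) R) = X := by
      funext i
      rcases i with i | i <;> rfl
    rw [this, subst_self, id]
  have s2 : ∀ j, subst (Sum.elim 0 X) (subst (Sum.elim (fun k => X (Sum.inl k))
      (fun k => X (Sum.inr (Sum.inl k)))) (F.law j) :
        MvPowerSeries (Fin g ⊕ (Fin g ⊕ Fin g)) R) =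
      (X (Sum.inl j) : MvPowerSeries (Fin g ⊕ Fin g) R) := fun j => by
    rw [subst_sumElim (by simp) (by simp) hc]
    have := congrArg (subst (fun l => X (Sum.inl l) :
      Fin g → MvPowerSeries (Fin g ⊕ Fin g) R)) (F.zero_law j)
    rw [subst_sumElim (by simp) (by simp) hX1, subst_X hX1] at this
    rw [← this]
    congr 1
    funext i
    rcases i with i | i
    · simp only [Sum.elim_inl, subst_X hc, Pi.zero_apply, ← coe_substAlgHom hX1, map_zero]
    · simp only [Sum.elim_inr, subst_X hc, Sum.elim_inl, subst_X hX1]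
  have s3 : ∀ j, subst (Sum.elim 0 X) (subst (Sum.elim (fun k => X (Sum.inr (Sum.inl k)))
      (fun k => X (Sum.inr (Sum.inr k)))) (F.law j) :
        MvPowerSeries (Fin g ⊕ (Fin g ⊕ Fin g)) R) = F.law j := fun j => by
    rw [subst_sumElim (by simp) (by simp) hc]
    simp only [subst_X hc, Sum.elim_inr]
    exact s1 _
  have s4 : ∀ j, subst (Sum.elim 0 X) (X (Sum.inr (Sum.inr j)) :
        MvPowerSeries (Fin g ⊕ (Fin g ⊕ Fin g)) R) =
      (X (Sum.inr j) : MvPowerSeries (Fin g ⊕ Fin g) R) := fun j => by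
    rw [subst_X hc, Sum.elim_inr]
  have s5 : ∀ j, subst (Sum.elim 0 X) (X (Sum.inl j) :
        MvPowerSeries (Fin g ⊕ (Fin g ⊕ Fin g)) R) =
      (0 : MvPowerSeries (Fin g ⊕ Fin g) R) := fun j => by
    rw [subst_X hc, Sum.elim_inl, Pi.zero_apply]
  simp only [s3, s5] at h'
  have h0 : (fun _ : Fin g => (0 : MvPowerSeries (Fin g ⊕ Fin g) R)) = 0 := rfl
  rw [h0] at h'
  have rhs : subst F.law (F.invariantMatrix i k) =
      subst (Sum.elim 0 F.law) (pderiv R (Sum.inl k) (F.law i)) := by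
    rw [invariantMatrix, subst_sumElim (by simp) (by simp) hL]
    simp only [subst_X hL, Pi.zero_apply, ← coe_substAlgHom hL, map_zero]
    rfl
  rw [rhs]
  refine Eq.trans ?_ h'
  refine Finset.sum_congr rfl fun j _ => ?_
  rw [subst_sumElim h1 (by simp) hc, subst_sumElim (by simp) (by simp) hc]
  simp only [s2, s4, s5]
  rw [s1, invariantMatrix, subst_sumElim (by simp) (by simp) hX1]
  simp only [subst_X hX1, subst_X hc, Pi.zero_apply, ← coe_substAlgHom hX1, map_zero,
    Sum.elim_inr]

/-- Invariance under translation of the first argument. -/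
theorem sum_inl_mul_invariantMatrix {τ : Type*} {a b : Fin g → MvPowerSeries τ R}
    (ha : ∀ i, constantCoeff (a i) = 0) (hb : ∀ i, constantCoeff (b i) = 0) (i k : Fin g) :
    ∑ j, subst (Sum.elim a b) (pderiv R (Sum.inl j) (F.law i)) *
        subst a (F.invariantMatrix j k) =
      subst (fun l => subst (Sum.elim a b) (F.law l)) (F.invariantMatrix i k) := by
  have hab := hasSubst_sumElim ha hb
  have hX1 : HasSubst (fun l => X (Sum.inl l) : Fin g → MvPowerSeries (Fin g ⊕ Fin g) R) :=
    hasSubst_of_constantCoeff_zero (by simp)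
  have hL : HasSubst F.law := hasSubst_of_constantCoeff_zero F.constantCoeff_law
  have h := congrArg (subst (Sum.elim a b)) (F.sum_pderiv_inl_mul_invariantMatrix_universal i k)
  rw [subst_comp_subst_apply hL hab, ← coe_substAlgHom hab, map_sum] at h
  simp only [map_mul, coe_substAlgHom hab, subst_comp_subst_apply hX1 hab, subst_X hab,
    Sum.elim_inl] at h
  exact h

theorem subst_swap_law {τ : Type*} {a b : Fin g → MvPowerSeries τ R}
    (ha : ∀ i, constantCoeff (a i) = 0) (hb : ∀ i, constantCoeff (b i) = 0) (i : Fin g) :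
    subst (Sum.elim a b) (F.law i) = subst (Sum.elim b a) (F.law i) := by
  have hba := hasSubst_sumElim hb ha
  have h := congrArg (subst (Sum.elim b a)) (F.comm i)
  rw [subst_sumElim (by simp) (by simp) hba] at h
  simpa only [subst_X hba, Sum.elim_inl, Sum.elim_inr] using h

/-- Follows by differentiating commutativity. It lets invariance in the first argument serve for the
second one as well. -/
theorem subst_pderiv_inr {τ : Type*} {a b : Fin g → MvPowerSeries τ R}
    (ha : ∀ i, constantCoeff (a i) = 0) (hb : ∀ i, constantCoeff (b i) = 0) (i k : Fin g) :
    subst (Sum.elim a b) (pderiv R (Sum.inr k) (F.law i)) =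
      subst (Sum.elim b a) (pderiv R (Sum.inl k) (F.law i)) := by
  have hab := hasSubst_sumElim ha hb
  have h := congrArg (pderiv R (Sum.inr k)) (F.comm i)
  rw [pderiv_subst_sumElim (by simp) (by simp)] at h
  have e1 : ∀ j, pderiv R (Sum.inr k) (X (Sum.inl j) :
      MvPowerSeries (Fin g ⊕ Fin g) R) = 0 := fun j => pderiv_X_of_ne (by simp)
  have e2 : ∀ j, pderiv R (Sum.inr k) (X (Sum.inr j) :
      MvPowerSeries (Fin g ⊕ Fin g) R) = if j = k then 1 else 0 := fun j => by
    split_ifs with hj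
    · rw [hj, pderiv_X_self]
    · exact pderiv_X_of_ne (by simpa using hj)
  simp only [e1, e2, mul_zero, Finset.sum_const_zero, add_zero, mul_ite, mul_one,
    Finset.sum_ite_eq', Finset.mem_univ, if_true] at h
  rw [← h, subst_sumElim (by simp) (by simp) hab]
  simp only [subst_X hab, Sum.elim_inl, Sum.elim_inr]

theorem constantCoeff_mulBy (n : ℕ) (i : Fin g) : constantCoeff (F.mulBy n i) = 0 := by
  induction n generalizing i with
  | zero => simp [mulBy]
  | succ n ih => exact F.constantCoeff_subst_law ih (by simp) i

/-- The Jacobian of `[n]` multiplies invariant vector fields by `n`. -/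
theorem sum_pderiv_mulBy_mul_invariantMatrix (n : ℕ) (i k : Fin g) :
    ∑ j, pderiv R j (F.mulBy n i) * F.invariantMatrix j k =
      n * subst (F.mulBy n) (F.invariantMatrix i k) := by
  classical
  induction n generalizing i with
  | zero => simp [mulBy]
  | succ n ih =>
    have hn := F.constantCoeff_mulBy n
    have hXX : ∀ f : MvPowerSeries (Fin g) R, subst X f = f := fun f => by
      rw [subst_self, id]
    -- In `[n+1](X) = F([n](X), X)`, varying the first argument contributes `n` copies of the
    -- invariant field at `[n+1](X)` (by `ih` and `h1`), varying the second contributes one (by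
    -- `h2`).
    have h1 := F.sum_inl_mul_invariantMatrix hn (b := X) (by simp) i k
    have h2 := F.sum_inl_mul_invariantMatrix (a := X) (by simp) hn i k
    simp only [hXX, ← F.subst_pderiv_inr hn (b := X) (by simp),
      ← F.subst_swap_law hn (b := X) (by simp)] at h2
    have hrec : F.mulBy (n + 1) = fun i => subst (Sum.elim (F.mulBy n) X) (F.law i) := rfl
    rw [hrec]
    have hd : ∀ j, pderiv R j (subst (Sum.elim (F.mulBy n) X) (F.law i)) =
      ∑ l, subst (Sum.elim (F.mulBy n) X) (pderiv R (Sum.inl l) (F.law i)) *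
        pderiv R j (F.mulBy n l) +
      subst (Sum.elim (F.mulBy n) X) (pderiv R (Sum.inr j) (F.law i)) := fun j => by
      rw [pderiv_subst_sumElim hn (by simp)]
      congr 1
      rw [Finset.sum_eq_single j]
      · simp
      · intro b _ hb
        rw [pderiv_X_of_ne hb, mul_zero]
      · simp
    simp only [hd, add_mul, Finset.sum_add_distrib, h2, Finset.sum_mul, mul_assoc]
    rw [Finset.sum_comm]
    simp only [← Finset.mul_sum, ih, mul_left_comm _ (n : MvPowerSeries (Fin g) R), h1]
    push_cast
    ring

theorem constantCoeff_invariantMatrix (i k : Fin g) :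
    constantCoeff (F.invariantMatrix i k) = if i = k then 1 else 0 := by
  have h := congrArg (pderiv R k) (F.law_zero i)
  rw [show (0 : Fin g → MvPowerSeries (Fin g) R) = fun _ => 0 from rfl,
    pderiv_subst_sumElim (by simp) (by simp)] at h
  have h' : subst (Sum.elim X fun _ => 0) (pderiv R (Sum.inl k) (F.law i)) =
      pderiv R k (X i : MvPowerSeries (Fin g) R) := by
    rw [← h, Finset.sum_eq_single k]
    · simp
    · intro b _ hb
      rw [pderiv_X_of_ne hb, mul_zero]
    · simp
  have h2 := congrArg constantCoeff h'
  rw [constantCoeff_subst_of_zero (hasSubst_sumElim (by simp) (by simp))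
    (by rintro (l | l) <;> simp)] at h2
  rw [invariantMatrix, constantCoeff_subst_of_zero (hasSubst_sumElim (by simp) (by simp))
    (by rintro (l | l) <;> simp), h2]
  split_ifs with hik
  · rw [hik, pderiv_X_self, map_one]
  · rw [pderiv_X_of_ne hik, map_zero]

/-- As `F(X, 0) = X`, the matrix is the identity at the origin, so its determinant has constant term
`1`. -/
theorem isUnit_invariantMatrix : IsUnit F.invariantMatrix := by
  rw [Matrix.isUnit_iff_isUnit_det, isUnit_iff_constantCoeff, RingHom.map_det]
  have : (constantCoeff (σ := Fin g) (R := R)).mapMatrix F.invariantMatrix = 1 := by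
    ext i k
    simp [constantCoeff_invariantMatrix, Matrix.one_apply]
  simp [this]

/-- All first partial derivatives of `[n]` are divisible by `n`. -/
theorem dvd_pderiv_mulBy (n : ℕ) (i j : Fin g) :
    (n : MvPowerSeries (Fin g) R) ∣ pderiv R j (F.mulBy n i) := by
  obtain ⟨u, hu⟩ := F.isUnit_invariantMatrix
  let J : Matrix (Fin g) (Fin g) (MvPowerSeries (Fin g) R) :=
    Matrix.of fun i j => pderiv R j (F.mulBy n i)
  have h : J * F.invariantMatrix =
      (n : MvPowerSeries (Fin g) R) • Matrix.of fun i k =>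
        subst (F.mulBy n) (F.invariantMatrix i k) := by
    ext1 i k
    simpa [J, Matrix.mul_apply] using F.sum_pderiv_mulBy_mul_invariantMatrix n i k
  have h2 : J = J * F.invariantMatrix * (↑u⁻¹ : Matrix _ _ _) := by
    rw [← hu, Units.mul_inv_cancel_right]
  rw [h, Matrix.smul_mul] at h2
  have h3 := congrFun (congrFun h2 i) j
  exact ⟨_, h3⟩

/-- The exponent `m j` is the factor that `∂_j` brings down. For `n = p` this forces unit
coefficients to sit at exponents divisible by `p`. -/
theorem dvd_mul_coeff_mulBy (n : ℕ) (i j : Fin g) (m : Fin g →₀ ℕ) :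
    (n : R) ∣ m j * coeff m (F.mulBy n i) := by
  rcases Nat.eq_zero_or_pos (m j) with hm | hm
  · simp [hm]
  obtain ⟨q, hq⟩ := F.dvd_pderiv_mulBy n i j
  have h := congrArg (coeff (m - Finsupp.single j 1)) hq
  have hle : Finsupp.single j 1 ≤ m := by
    simpa using Nat.succ_le_of_lt hm
  have hc : (n : MvPowerSeries (Fin g) R) * q = (n : R) • q := by
    rw [Nat.cast_smul_eq_nsmul, nsmul_eq_mul]
  rw [coeff_pderiv, tsub_add_cancel_of_le hle, hc, coeff_smul] at h
  refine ⟨_, Eq.trans ?_ h⟩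
  have : (((m - Finsupp.single j 1 : Fin g →₀ ℕ) j : ℕ) : R) + 1 = m j := by
    rw [Finsupp.tsub_apply, Finsupp.single_eq_same]
    exact_mod_cast congrArg (Nat.cast (R := R)) (Nat.sub_add_cancel hm)
  rw [this, mul_comm]

/-- Constant term of the Jacobian identity, the invariant matrix being the identity at the origin.
-/
theorem coeff_single_mulBy (n : ℕ) (i j : Fin g) :
    coeff (Finsupp.single j 1) (F.mulBy n i) = if i = j then (n : R) else 0 := by
  have h := congrArg constantCoeff (F.sum_pderiv_mulBy_mul_invariantMatrix n i j)
  rw [map_mul, constantCoeff_subst_of_zero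
    (hasSubst_of_constantCoeff_zero (F.constantCoeff_mulBy n)) (F.constantCoeff_mulBy n)] at h
  simp only [map_sum, map_mul, constantCoeff_invariantMatrix, map_natCast] at h
  simp only [mul_ite, mul_one, mul_zero, Finset.sum_ite_eq', Finset.mem_univ, if_true] at h
  rw [← h, ← coeff_zero_eq_constantCoeff_apply, coeff_pderiv]
  simp

end FormalGroupLaw

end

/-! ### Vanishing of differentials: descent to subalgebras, and monogenic algebras. -/

namespace KaehlerDifferential

/-- The map on free modules on the elements of an algebra induced by an algebra homomorphism. -/
def finsuppMapAlong {R B S : Type*} [CommRing R] [CommRing B] [CommRing S] [Algebra R B]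
    [Algebra R S] (φ : B →ₐ[R] S) : (B →₀ B) →+ (S →₀ S) :=
  (Finsupp.mapDomain.addMonoidHom φ).comp (Finsupp.mapRange.addMonoidHom (φ : B →+ S))

section

variable {R B S : Type*} [CommRing R] [CommRing B] [CommRing S] [Algebra R B] [Algebra R S]

theorem finsuppMapAlong_single (φ : B →ₐ[R] S) (x y : B) :
    finsuppMapAlong φ (Finsupp.single x y) = Finsupp.single (φ x) (φ y) := by
  simp [finsuppMapAlong, Finsupp.mapDomain_single]

theorem finsuppMapAlong_smul (φ : B →ₐ[R] S) (c : B) (w : B →₀ B) :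
    finsuppMapAlong φ (c • w) = φ c • finsuppMapAlong φ w := by
  induction w using Finsupp.induction_linear with
  | zero => simp
  | add v w hv hw => simp only [smul_add, map_add, hv, hw]
  | single x y => simp only [Finsupp.smul_single, smul_eq_mul, finsuppMapAlong_single, map_mul]

theorem finsuppMapAlong_injective (φ : B →ₐ[R] S) (hφ : Function.Injective φ) :
    Function.Injective (finsuppMapAlong φ) :=
  (Finsupp.mapDomain_injective hφ).comp
    (Finsupp.mapRange_injective _ (map_zero (φ : B →+ S)) hφ)

end

/-- A relation between differentials of `S` already holds in every subalgebra that contains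
a suitable finite set. -/
theorem exists_finite_of_mem_kerTotal (R : Type*) {S : Type*} [CommRing R] [CommRing S]
    [Algebra R S] {w : S →₀ S} (hw : w ∈ kerTotal R S) :
    ∃ Y : Set S, Y.Finite ∧ ∀ (B : Type*) [CommRing B] [Algebra R B] (φ : B →ₐ[R] S),
      Y ⊆ Set.range φ → ∃ w' ∈ kerTotal R B, finsuppMapAlong φ w' = w := by
  unfold kerTotal at hw
  induction hw using Submodule.span_induction with
  | mem w hw =>
    rcases hw with (⟨⟨x, y⟩, rfl⟩ | ⟨⟨x, y⟩, rfl⟩) | ⟨x, rfl⟩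
    · refine ⟨{x, y}, by simp, fun B _ _ φ hφ => ?_⟩
      obtain ⟨x, rfl⟩ := hφ (Set.mem_insert _ _)
      obtain ⟨y, rfl⟩ := hφ (Set.mem_insert_of_mem _ rfl)
      refine ⟨_, Submodule.subset_span (Or.inl (Or.inl ⟨(x, y), rfl⟩)), ?_⟩
      simp [finsuppMapAlong_single]
    · refine ⟨{x, y}, by simp, fun B _ _ φ hφ => ?_⟩
      obtain ⟨x, rfl⟩ := hφ (Set.mem_insert _ _)
      obtain ⟨y, rfl⟩ := hφ (Set.mem_insert_of_mem _ rfl)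
      refine ⟨_, Submodule.subset_span (Or.inl (Or.inr ⟨(x, y), rfl⟩)), ?_⟩
      simp [finsuppMapAlong_single]
    · refine ⟨∅, by simp, fun B _ _ φ _ => ?_⟩
      refine ⟨_, Submodule.subset_span (Or.inr ⟨x, rfl⟩), ?_⟩
      simp [finsuppMapAlong_single]
  | zero => exact ⟨∅, by simp, fun B _ _ φ _ => ⟨0, zero_mem _, map_zero _⟩⟩
  | add v w _ _ hv hw =>
    obtain ⟨Y, hY, h⟩ := hv
    obtain ⟨Z, hZ, h'⟩ := hw
    refine ⟨Y ∪ Z, hY.union hZ, fun B _ _ φ hφ => ?_⟩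
    obtain ⟨v', hv', rfl⟩ := h B φ (Set.subset_union_left.trans hφ)
    obtain ⟨w', hw', rfl⟩ := h' B φ (Set.subset_union_right.trans hφ)
    exact ⟨v' + w', add_mem hv' hw', map_add _ _ _⟩
  | smul c w _ hw =>
    obtain ⟨Y, hY, h⟩ := hw
    refine ⟨insert c Y, hY.insert c, fun B _ _ φ hφ => ?_⟩
    obtain ⟨w', hw', rfl⟩ := h B φ ((Set.subset_insert _ _).trans hφ)
    obtain ⟨c, rfl⟩ := hφ (Set.mem_insert _ _)
    exact ⟨c • w', Submodule.smul_mem _ _ hw', finsuppMapAlong_smul _ _ _⟩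

/-- `D x = 0` says that the generator at `x` is a combination of the defining relations, which
involves finitely many elements. Injectivity of `φ` identifies the lifted combination with the
generator at `x'`. -/
theorem exists_finite_of_D_eq_zero (R : Type*) {S : Type*} [CommRing R] [CommRing S]
    [Algebra R S] {x : S} (hx : D R S x = 0) :
    ∃ Y : Set S, Y.Finite ∧ ∀ (B : Type*) [CommRing B] [Algebra R B] (φ : B →ₐ[R] S),
      Function.Injective φ → Y ⊆ Set.range φ → ∀ x', φ x' = x → D R B x' = 0 := by
  have hw : Finsupp.single x 1 ∈ kerTotal R S := by
    rw [← kerTotal_eq]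
    simpa using hx
  obtain ⟨Y, hY, h⟩ := exists_finite_of_mem_kerTotal R hw
  refine ⟨Y, hY, fun B _ _ φ hφ hYφ x' hx' => ?_⟩
  obtain ⟨w', hw', h'⟩ := h B φ hYφ
  have : w' = Finsupp.single x' 1 := by
    apply finsuppMapAlong_injective φ hφ
    rw [h', finsuppMapAlong_single, hx', map_one]
  rw [← kerTotal_eq, this] at hw'
  simpa using hw'

open Polynomial in
/-- In a monogenic algebra the differential of `h(π)` vanishes only if `h'(π)` is divisible by
`E'(π)`, where `E` generates the relations of `π`. -/
theorem aeval_derivative_dvd_of_D_eq_zero {A B : Type*} [CommRing A] [CommRing B] [Algebra A B]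
    {π : B} (hπ : Function.Surjective (aeval π : A[X] →ₐ[A] B)) {E : A[X]}
    (hE : ∀ q : A[X], aeval π q = 0 → E ∣ q) (hE0 : aeval π E = 0) {h : A[X]}
    (hD : D A B (aeval π h) = 0) :
    aeval π (derivative E) ∣ aeval π (derivative h) := by
  let I : Ideal B := Ideal.span {aeval π (derivative E)}
  let s : B → A[X] := Function.surjInv hπ
  have hs : ∀ b, aeval π (s b) = b := Function.surjInv_eq hπ
  -- Modulo `E'(π)` the value `q'(π)` depends only on `q(π)`, because `(E c)'(π) = E'(π) c(π)`. The
  -- resulting derivation of `B` factors through the universal one, so it kills `h(π)`.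
  let δ : A[X] → B ⧸ I := fun q => Ideal.Quotient.mk I (aeval π (derivative q))
  have key : ∀ q r : A[X], aeval π q = aeval π r → δ q = δ r := by
    intro q r hqr
    obtain ⟨c, hc⟩ := hE (q - r) (by rw [map_sub, hqr, sub_self])
    have : q = r + E * c := by rw [← hc]; ring
    simp only [δ, this, derivative_mul, map_add, map_mul, hE0, zero_mul,
      add_zero]
    rw [Ideal.Quotient.eq_zero_iff_mem.mpr (Ideal.mem_span_singleton_self _)]
    simp
  let Δ : Derivation A B (B ⧸ I) :=
    { toFun := fun b => δ (s b)
      map_add' := fun a b => by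
        rw [key (s (a + b)) (s a + s b) (by simp [hs])]
        simp [δ]
      map_smul' := fun r b => by
        rw [key (s (r • b)) (r • s b) (by simp [hs])]
        simp only [δ, map_smul, RingHom.id_apply]
        rfl
      map_one_eq_zero' := by
        change δ (s 1) = 0
        rw [key (s 1) 1 (by simp [hs])]
        simp [δ]
      leibniz' := fun a b => by
        change δ (s (a * b)) = a • δ (s b) + b • δ (s a)
        rw [key (s (a * b)) (s a * s b) (by simp [hs])]
        simp only [δ, derivative_mul, map_add, map_mul, hs, Algebra.smul_def]
        change _ = Ideal.Quotient.mk I a * _ + Ideal.Quotient.mk I b * _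
        ring }
  have h1 : Δ (aeval π h) = 0 := by
    rw [← Derivation.liftKaehlerDifferential_comp_D, hD, map_zero]
  have h2 : δ (s (aeval π h)) = 0 := h1
  rw [key _ h (hs _)] at h2
  exact Ideal.mem_span_singleton.mp (Ideal.Quotient.eq_zero_iff_mem.mp h2)

end KaehlerDifferential

/-! ### Finite extensions of complete discrete valuation rings: locality and total ramification. -/

theorem smodEq_span_singleton_pow_iff {A M : Type*} [CommRing A] [AddCommGroup M] [Module A M]
    (a : A) (n : ℕ) (x y : M) :
    x ≡ y [SMOD (Ideal.span {a} ^ n • ⊤ : Submodule A M)] ↔ ∃ z, a ^ n • z = x - y := by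
  rw [SModEq.sub_mem, Ideal.span_singleton_pow, Submodule.ideal_span_singleton_smul,
    Submodule.mem_smul_pointwise_iff_exists]
  simp

theorem IsPrecomplete.of_free_finite {A M : Type*} [CommRing A] [AddCommGroup M] [Module A M]
    [Module.Free A M] [Module.Finite A M] (a : A) [IsPrecomplete (Ideal.span {a}) A] :
    IsPrecomplete (Ideal.span {a}) M := by
  refine ⟨fun f hf => ?_⟩
  simp only [smodEq_span_singleton_pow_iff] at hf ⊢
  let b := Module.Free.chooseBasis A M
  have h (i) : ∃ c : A, ∀ n, ∃ z, a ^ n • z = b.repr (f n) i - c := by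
    have := IsPrecomplete.prec (I := Ideal.span {a}) (M := A) inferInstance
      (f := fun n => b.repr (f n) i)
    simp only [smodEq_span_singleton_pow_iff] at this
    refine this fun {m n} hmn => ?_
    obtain ⟨z, hz⟩ := hf hmn
    refine ⟨b.repr z i, ?_⟩
    have := congrArg (fun w => b.repr w i) hz
    simpa using this
  choose c hc using h
  refine ⟨∑ i, c i • b i, fun n => ?_⟩
  choose z hz using fun i => hc i n
  refine ⟨∑ i, z i • b i, ?_⟩
  conv_rhs => rw [← b.sum_repr (f n)]
  rw [Finset.smul_sum, ← Finset.sum_sub_distrib]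
  refine Finset.sum_congr rfl fun i _ => ?_
  rw [← sub_smul, ← hz i, smul_assoc]

open Polynomial in
/-- Modulo `ϖ` the descending chain of powers of an integral element becomes stationary. -/
theorem exists_dvd_pow_sub_of_isIntegral {A B k : Type*} [CommRing A] [CommRing B] [Algebra A B]
    [Field k] {ϖ : A} {ϕ : A →+* k} (hϕ : Function.Surjective ϕ)
    (hker : RingHom.ker ϕ = Ideal.span {ϖ}) {x : B} (hx : IsIntegral A x) :
    ∃ (n : ℕ) (y : B), algebraMap A B ϖ ∣ x ^ n - x ^ (n + 1) * y := by
  have hdvd : ∀ {q : A[X]}, q.map ϕ = 0 → ∃ r, q = C ϖ * r := fun {q} hq => by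
    refine (C_dvd_iff_dvd_coeff _ _).mpr fun i => ?_
    rw [← Ideal.mem_span_singleton, ← hker, RingHom.mem_ker, ← coeff_map, hq, coeff_zero]
  obtain ⟨q, hq, hqx⟩ := hx
  have hq0 : q.map ϕ ≠ 0 := (hq.map ϕ).ne_zero
  obtain ⟨s', hs', hs0⟩ := exists_eq_pow_rootMultiplicity_mul_and_not_dvd _ hq0 0
  set n := rootMultiplicity 0 (q.map ϕ)
  rw [C_0, sub_zero] at hs' hs0
  obtain ⟨s, rfl⟩ := map_surjective ϕ hϕ s'
  obtain ⟨r, hr⟩ := hdvd (q := q - X ^ n * s) (by simp [← hs'])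
  have hc : ϕ (s.coeff 0) ≠ 0 := by rwa [X_dvd_iff, coeff_map] at hs0
  obtain ⟨c, hc'⟩ := hϕ (ϕ (s.coeff 0))⁻¹
  have hcs : s.coeff 0 * c - 1 ∈ Ideal.span {ϖ} := by
    rw [← hker, RingHom.mem_ker]
    simp [hc', hc]
  obtain ⟨t, ht⟩ := Ideal.mem_span_singleton.mp hcs
  -- Modulo `ϖ`, `x^n s(x) = 0` with `s(x) = s(0) + x s₁(x)`. Multiplying by an inverse `c` of
  -- `s(0)` gives `y = -s₁(x) c`.
  refine ⟨n, - aeval x s.divX * algebraMap A B c,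
    - aeval x r * algebraMap A B c - x ^ n * algebraMap A B t, ?_⟩
  have h1 := congrArg (aeval x) hr
  rw [← divX_mul_X_add s] at h1
  have hqx' : aeval x q = 0 := hqx
  simp only [map_sub, map_mul, map_add, map_pow, aeval_X, aeval_C, hqx', zero_sub] at h1
  have h2 := congrArg (algebraMap A B) ht
  simp only [map_sub, map_mul, map_one] at h2
  linear_combination (-algebraMap A B c) * h1 - x ^ n * h2

/-- For a suitable `m`, `x^m y^m` is idempotent modulo `ϖ`, and Hensel lifts it to an idempotent of
the domain `B`, that is, to `0` or `1`. The value `1` makes `x` a unit; the value `0` gives `ϖ ∣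
x^m`, which makes `1 - x` a unit. -/
theorem isUnit_or_isUnit_of_henselian {B : Type*} [CommRing B] [IsDomain B] {ϖ : B}
    [HenselianRing B (Ideal.span {ϖ})] {x : B} {n : ℕ} {y : B}
    (hxy : ϖ ∣ x ^ n - x ^ (n + 1) * y) : IsUnit x ∨ IsUnit (1 - x) := by
  have hjac : ∀ {z : B}, ϖ ∣ z - 1 → IsUnit z := fun {z} hz => by
    have h : z - 1 ∈ Ideal.jacobson (⊥ : Ideal B) :=
      HenselianRing.jac (Ideal.mem_span_singleton.mpr hz)
    have := Ideal.mem_jacobson_bot.mp h 1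
    simpa using this
  have hk : ∀ k, ϖ ∣ x ^ n - x ^ (n + k) * y ^ k := fun k => by
    induction k with
    | zero => simp
    | succ k ih =>
      have h := dvd_add ih (hxy.mul_left (x ^ k * y ^ k))
      convert h using 1
      ring
  obtain ⟨m, hm, hmm⟩ : ∃ m, 0 < m ∧ ϖ ∣ x ^ m - x ^ (m + m) * y ^ m := by
    refine ⟨n + 1, n.succ_pos, ?_⟩
    convert (hk (n + 1)).mul_left x using 1
    ring
  have hidem : ϖ ∣ (x ^ m * y ^ m) ^ 2 - x ^ m * y ^ m := by
    convert hmm.mul_left (- y ^ m) using 1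
    ring
  obtain ⟨e, he, hed⟩ := HenselianRing.is_henselian (I := Ideal.span {ϖ})
    (Polynomial.X ^ 2 - Polynomial.X : Polynomial B)
    (by monicity!)
    (x ^ m * y ^ m)
    (by
      rw [Ideal.mem_span_singleton]
      simpa using hidem)
    (by
      -- The derivative `2a - 1` is its own inverse modulo `ϖ`, since `(2a - 1)² - 1 = 4(a² - a)`.
      refine IsUnit.of_mul_eq_one (Ideal.Quotient.mk (Ideal.span {ϖ}) (2 * (x ^ m * y ^ m) - 1)) ?_
      rw [← map_mul, ← map_one (Ideal.Quotient.mk (Ideal.span {ϖ})), Ideal.Quotient.eq,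
        Ideal.mem_span_singleton]
      convert hidem.mul_left 4 using 1
      simp only [Polynomial.derivative_sub, Polynomial.derivative_X_pow, Polynomial.derivative_X,
        Polynomial.eval_sub, Polynomial.eval_mul, Polynomial.eval_pow, Polynomial.eval_X,
        Polynomial.eval_C, Polynomial.eval_one]
      push_cast
      ring)
  rw [Ideal.mem_span_singleton] at hed
  have he' : e * (e - 1) = 0 := by
    have : e ^ 2 - e = 0 := by simpa [Polynomial.IsRoot] using he
    linear_combination this
  rcases mul_eq_zero.mp he' with h0 | h1
  · right
    have h2 : ϖ ∣ x ^ m := by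
      convert dvd_add hmm (hed.mul_left (- x ^ m)) using 1
      rw [h0]
      ring
    have h3 : IsUnit (1 - x ^ m) := hjac (by
      convert (dvd_neg.mpr h2) using 1
      ring)
    exact isUnit_of_dvd_unit (by simpa using sub_dvd_pow_sub_pow 1 x m) h3
  · left
    have h2 : IsUnit (x ^ m * y ^ m) := hjac (by
      convert (dvd_neg.mpr hed) using 1
      linear_combination h1)
    exact isUnit_of_dvd_unit ((dvd_pow_self x hm.ne').mul_right _) h2

/-- A uniformizer `π` of ramification index `e` that generates `B` over `A`, with the minimal
polynomial `E` of `π`. Here `ϕ` is the residue map of `A` and `ϖ` a uniformizer of `A`. -/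
structure IsUniformizingGenerator {A B k : Type*} [CommRing A] [CommRing B] [Algebra A B] [Field k]
    (ϖ : A) (ϕ : A →+* k) (π : B) (e : ℕ) (E : Polynomial A) : Prop where
  pos : 0 < e
  prime : Prime π
  associated : ∀ x : B, x ≠ 0 → ∃ n, Associated x (π ^ n)
  associated_algebraMap : Associated (algebraMap A B ϖ) (π ^ e)
  surjective : Function.Surjective (Polynomial.aeval π : Polynomial A →ₐ[A] B)
  dvd : ∀ q : Polynomial A, Polynomial.aeval π q = 0 → E ∣ q
  aeval_eq_zero : Polynomial.aeval π E = 0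
  map_eq : E.map ϕ = Polynomial.X ^ e
  aeval_derivative_ne_zero : Polynomial.aeval π (Polynomial.derivative E) ≠ 0

section Extension

variable {A B k : Type*} [CommRing A] [CommRing B] [Algebra A B]
  [Field k] {ϖ : A} {ϕ : A →+* k}

/-- `B` is finite and free over `A`, hence `ϖ`-adically complete and so Henselian. Integrality then
supplies the input for the unit dichotomy. -/
theorem IsLocalRing.of_finite_of_isAdicComplete [IsDomain A] [IsPrincipalIdealRing A]
    [IsDomain B] [Module.Finite A B] [Module.IsTorsionFree A B]
    (hϕ : Function.Surjective ϕ) (hker : RingHom.ker ϕ = Ideal.span {ϖ})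
    [IsAdicComplete (Ideal.span {ϖ}) A] :
    IsLocalRing B ∧ algebraMap A B ϖ ∈ Ideal.jacobson (⊥ : Ideal B) := by
  have hI : Ideal.span {ϖ} ≠ ⊤ := hker ▸ RingHom.ker_ne_top ϕ
  have : IsPrecomplete (Ideal.span {ϖ}) B := IsPrecomplete.of_free_finite ϖ
  have : IsHausdorff (Ideal.span {ϖ}) B := IsHausdorff.of_isTorsionFree _ _ hI
  have hmap : (Ideal.span {ϖ}).map (algebraMap A B) = Ideal.span {algebraMap A B ϖ} := by
    rw [Ideal.map_span, Set.image_singleton]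
  have : IsAdicComplete (Ideal.span {algebraMap A B ϖ}) B := by
    rw [← hmap, IsAdicComplete.map_algebraMap_iff]
    exact { }
  have : HenselianRing B (Ideal.span {algebraMap A B ϖ}) := inferInstance
  refine ⟨IsLocalRing.of_isUnit_or_isUnit_one_sub_self fun x => ?_,
    HenselianRing.jac (Ideal.mem_span_singleton_self _)⟩
  obtain ⟨n, y, hxy⟩ := exists_dvd_pow_sub_of_isIntegral hϕ hker
    (Algebra.IsIntegral.isIntegral (R := A) x)
  exact isUnit_or_isUnit_of_henselian hxy

/-- The residue field does not grow in an integral extension if it is algebraically closed. -/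
theorem exists_sub_mem_maximalIdeal [IsLocalRing B] [Algebra.IsIntegral A B] [IsAlgClosed k]
    (hϕ : Function.Surjective ϕ) (hker : RingHom.ker ϕ = Ideal.span {ϖ})
    (hϖ : algebraMap A B ϖ ∈ IsLocalRing.maximalIdeal B) (b : B) :
    ∃ a : A, b - algebraMap A B a ∈ IsLocalRing.maximalIdeal B := by
  let ψ : A →+* IsLocalRing.ResidueField B := (IsLocalRing.residue B).comp (algebraMap A B)
  have hψ : RingHom.ker ϕ ≤ RingHom.ker ψ := by
    rw [hker, Ideal.span_singleton_le_iff_mem, RingHom.mem_ker]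
    exact (IsLocalRing.residue_eq_zero_iff _).mpr hϖ
  let θ := RingHom.liftOfSurjective ϕ hϕ ⟨ψ, hψ⟩
  have hθ : θ.comp ϕ = ψ := RingHom.liftOfSurjective_comp ϕ hϕ ⟨ψ, hψ⟩
  have hint : θ.IsIntegral := by
    refine RingHom.IsIntegral.tower_top ϕ θ ?_
    rw [hθ]
    exact RingHom.IsIntegral.trans _ _ (algebraMap_isIntegral_iff.mpr inferInstance)
      (RingHom.isIntegral_of_surjective _ IsLocalRing.residue_surjective)
  obtain ⟨c, hc⟩ := (IsAlgClosed.ringHom_bijective_of_isIntegral θ hint).2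
    (IsLocalRing.residue B b)
  obtain ⟨a, rfl⟩ := hϕ c
  refine ⟨a, ?_⟩
  rw [← IsLocalRing.residue_eq_zero_iff, map_sub, ← hc, sub_eq_zero]
  exact congrArg (fun f => f a) hθ

/-- Expanding in powers of `π` with digits from `A` reaches every element modulo `π^e`, hence modulo
`ϖ`; Nakayama does the rest. -/
theorem adjoin_eq_top_of_uniformizer [IsLocalRing A] [IsLocalRing B] [Module.Finite A B]
    {π : B} {e : ℕ}
    (hϖ : ϖ ∈ IsLocalRing.maximalIdeal A)
    (hmax : ∀ b : B, ∃ a : A, π ∣ b - algebraMap A B a)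
    (he : algebraMap A B ϖ ∣ π ^ e) :
    Function.Surjective (Polynomial.aeval π : Polynomial A →ₐ[A] B) := by
  have h : ∀ (n : ℕ) (b : B), ∃ (q : Polynomial A) (t : B),
      b = Polynomial.aeval π q + π ^ n * t := fun n => by
    induction n with
    | zero => exact fun b => ⟨0, b, by simp⟩
    | succ n ih =>
      intro b
      obtain ⟨q, t, rfl⟩ := ih b
      obtain ⟨a, s, hs⟩ := hmax t
      refine ⟨q + Polynomial.C a * Polynomial.X ^ n, s, ?_⟩
      rw [map_add, map_mul, Polynomial.aeval_C, map_pow, Polynomial.aeval_X]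
      linear_combination π ^ n * hs
  have hle : (⊤ : Submodule A B) ≤
      (Polynomial.aeval π : Polynomial A →ₐ[A] B).toLinearMap.range := by
    refine Submodule.le_of_le_smul_of_le_jacobson_bot (I := IsLocalRing.maximalIdeal A)
      Module.Finite.fg_top (IsLocalRing.maximalIdeal_le_jacobson _) fun b _ => ?_
    obtain ⟨q, t, rfl⟩ := h e b
    obtain ⟨c, hc⟩ := he
    refine Submodule.add_mem_sup ⟨q, rfl⟩ ?_
    rw [hc, mul_assoc, ← Algebra.smul_def]
    exact Submodule.smul_mem_smul hϖ trivial
  intro b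
  exact hle (Submodule.mem_top (x := b))

open Polynomial in
/-- Finite extensions of a complete discrete valuation ring with
algebraically closed residue field are totally ramified, hence generated by a uniformizer. -/
theorem exists_isUniformizingGenerator [IsDomain A] [IsDiscreteValuationRing A] [CharZero A]
    [IsDedekindDomain B] [Module.Finite A B] [Module.IsTorsionFree A B] [IsAlgClosed k]
    (hϖ : Irreducible ϖ) (hϕ : Function.Surjective ϕ)
    (hker : RingHom.ker ϕ = Ideal.span {ϖ}) [IsAdicComplete (Ideal.span {ϖ}) A] :
    ∃ (π : B) (e : ℕ) (E : A[X]), IsUniformizingGenerator ϖ ϕ π e E := by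
  obtain ⟨hloc, hjac⟩ := IsLocalRing.of_finite_of_isAdicComplete (B := B) hϕ hker
  have hinj : Function.Injective (algebraMap A B) := FaithfulSMul.algebraMap_injective A B
  have hϖ0 : algebraMap A B ϖ ≠ 0 := by
    rw [Ne, map_eq_zero_iff _ hinj]
    exact hϖ.ne_zero
  have hϖm : algebraMap A B ϖ ∈ IsLocalRing.maximalIdeal B := by
    rwa [IsLocalRing.jacobson_eq_maximalIdeal _ bot_ne_top] at hjac
  have hfield : ¬ IsField B := by
    rw [IsLocalRing.isField_iff_maximalIdeal_eq]
    intro h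
    rw [h] at hϖm
    exact hϖ0 hϖm
  have : IsDiscreteValuationRing B :=
    ((IsDiscreteValuationRing.TFAE B hfield).out 0 2).mpr ‹IsDedekindDomain B›
  obtain ⟨π, hπ⟩ := IsDiscreteValuationRing.exists_irreducible B
  obtain ⟨e, he⟩ := IsDiscreteValuationRing.associated_pow_irreducible hϖ0 hπ
  have hmax : IsLocalRing.maximalIdeal B = Ideal.span {π} := hπ.maximalIdeal_eq
  have hpos : 0 < e := by
    rw [pos_iff_ne_zero]
    rintro rfl
    rw [pow_zero, associated_one_iff_isUnit] at he
    exact hϖm he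
  have hsurj : Function.Surjective (aeval π : A[X] →ₐ[A] B) := by
    refine adjoin_eq_top_of_uniformizer (ϖ := ϖ) (e := e) hϖ.not_isUnit (fun b => ?_) he.dvd
    obtain ⟨a, ha⟩ := exists_sub_mem_maximalIdeal hϕ hker hϖm b
    exact ⟨a, by rwa [hmax, Ideal.mem_span_singleton] at ha⟩
  have hint : IsIntegral A π := Algebra.IsIntegral.isIntegral π
  have hmonic := minpoly.monic hint
  have hdvd : ∀ q : A[X], aeval π q = 0 → minpoly A π ∣ q := fun q hq =>
    minpoly.isIntegrallyClosed_dvd hint hq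
  have hϕϖ : ϕ ϖ = 0 := by
    rw [← RingHom.mem_ker, hker]
    exact Ideal.mem_span_singleton_self _
  refine ⟨π, e, minpoly A π, hpos, hπ.prime, fun x hx =>
    IsDiscreteValuationRing.associated_pow_irreducible hx hπ, he, hsurj, hdvd,
    minpoly.aeval A π, ?_, ?_⟩
  -- With `π^e = ϖ w(π)`, the minimal polynomial divides `X^e - ϖ w`, so it reduces to some `X^j`
  -- with `j ≤ e`. Conversely it kills `π`, so `ϖ` divides `π^j` and `e ≤ j`.
  · obtain ⟨c, hc⟩ := he.dvd
    obtain ⟨w, rfl⟩ := hsurj c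
    have h1 := hdvd (X ^ e - C ϖ * w) (by simp [hc])
    have h2 := Polynomial.map_dvd ϕ h1
    simp only [Polynomial.map_sub, Polynomial.map_pow, map_X, Polynomial.map_mul, map_C, hϕϖ,
      C_0, zero_mul, sub_zero] at h2
    obtain ⟨j, hj, hj'⟩ := (dvd_prime_pow prime_X e).mp h2
    have h3 : (minpoly A π).map ϕ = X ^ j :=
      eq_of_monic_of_associated (hmonic.map ϕ) (monic_X_pow j) hj'
    obtain ⟨r, hr⟩ : C ϖ ∣ minpoly A π - X ^ j := by
      refine (C_dvd_iff_dvd_coeff _ _).mpr fun i => ?_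
      rw [← Ideal.mem_span_singleton, ← hker, RingHom.mem_ker, ← coeff_map]
      simp [h3]
    have h4 := congrArg (aeval π) hr
    simp only [map_sub, minpoly.aeval, map_pow, aeval_X, zero_sub, map_mul, aeval_C] at h4
    have h5 : π ^ e ∣ π ^ j := by
      rw [← dvd_neg, h4]
      exact he.symm.dvd.mul_right _
    rw [h3, le_antisymm hj ((pow_dvd_pow_iff hπ.ne_zero hπ.not_isUnit).mp h5)]
  -- The derivative is nonzero in characteristic zero and has smaller degree than the minimal
  -- polynomial, so it cannot vanish at `π`.
  · intro h
    have h1 := hdvd _ h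
    have hdeg : 0 < (minpoly A π).natDegree := minpoly.natDegree_pos hint
    refine hmonic.not_dvd_of_natDegree_lt ?_ (natDegree_derivative_lt hdeg.ne') h1
    intro h0
    exact hdeg.ne' (derivative_eq_zero.mp h0)

end Extension

/-! ### Derivatives and lowest-order terms of polynomial substitutions. -/

section MvPolynomialLemmas

theorem Finsupp.exists_eq_single_of_degree_eq_one {σ : Type*} (α : σ →₀ ℕ) (h : α.degree = 1) :
    ∃ j, α = Finsupp.single j 1 := by
  have h0 : α ≠ 0 := by
    rintro rfl
    simp at h
  obtain ⟨j, hj⟩ := Finsupp.ne_iff.mp h0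
  have hle : Finsupp.single j 1 ≤ α := by
    simpa using Nat.one_le_iff_ne_zero.mpr hj
  obtain ⟨β, rfl⟩ := exists_add_of_le hle
  have hβ : β.degree = 0 := by
    rw [map_add, Finsupp.degree_single] at h
    omega
  exact ⟨j, by rw [(Finsupp.degree_eq_zero_iff β).mp hβ, add_zero]⟩

theorem Polynomial.derivative_mvPolynomial_aeval {A : Type*} [CommRing A] {σ : Type*} [Fintype σ]
    (h : σ → Polynomial A) (f : MvPolynomial σ A) :
    derivative (MvPolynomial.aeval h f) =
      ∑ j, MvPolynomial.aeval h (MvPolynomial.pderiv j f) * derivative (h j) := by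
  classical
  induction f using MvPolynomial.induction_on with
  | C r => simp
  | add q q' hq hq' => simp [hq, hq', add_mul, Finset.sum_add_distrib]
  | mul_X q i hq =>
    have key : ∀ j, MvPolynomial.aeval h (MvPolynomial.pderiv j (q * MvPolynomial.X i)) *
        derivative (h j) = MvPolynomial.aeval h (MvPolynomial.pderiv j q) * derivative (h j) * h i +
          if j = i then MvPolynomial.aeval h q * derivative (h i) else 0 := fun j => by
      rw [MvPolynomial.pderiv_mul, map_add, map_mul, map_mul, MvPolynomial.aeval_X]
      split_ifs with hj
      · rw [hj, MvPolynomial.pderiv_X_self, map_one]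
        ring
      · rw [MvPolynomial.pderiv_X_of_ne (Ne.symm hj), map_zero]
        ring
    simp only [key, Finset.sum_add_distrib, ← Finset.sum_mul, Finset.sum_ite_eq',
      Finset.mem_univ, if_true]
    rw [map_mul, MvPolynomial.aeval_X, derivative_mul, hq]

theorem prod_pow_mul_pow {σ B : Type*} [Fintype σ] [CommRing B] (c : B) (m : ℕ) (y : σ → B)
    (α : σ →₀ ℕ) : ∏ j, (c ^ m * y j) ^ α j = c ^ (m * α.degree) * ∏ j, y j ^ α j := by
  simp only [mul_pow, Finset.prod_mul_distrib, ← pow_mul, Finset.prod_pow_eq_pow_sum,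
    ← Finset.mul_sum, Finsupp.degree_eq_sum]

open Polynomial in
/-- The lowest coefficient of a polynomial in power series of order at least `m`. -/
theorem eval_homogeneousComponent_eq_zero {k σ : Type*} [Field k] [Fintype σ] {d m r : ℕ}
    (hm : 0 < m) (hr : m * d < r) {F : MvPolynomial σ k}
    (hF : ∀ α : σ →₀ ℕ, α.degree < d → F.coeff α = 0) (u : σ → k[X])
    (h : X ^ r ∣ MvPolynomial.aeval (fun j => X ^ m * u j) F) :
    MvPolynomial.eval (fun j => (u j).eval 0) (MvPolynomial.homogeneousComponent d F) = 0 := by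
  have h1 : MvPolynomial.aeval (fun j => X ^ m * u j) F = X ^ (m * d) *
      ∑ α ∈ F.support, C (F.coeff α) * (X ^ (m * (α.degree - d)) * ∏ j, u j ^ α j) := by
    rw [MvPolynomial.aeval_def, MvPolynomial.eval₂_eq', Finset.mul_sum]
    refine Finset.sum_congr rfl fun α hα => ?_
    have hle : d ≤ α.degree := by
      by_contra hlt
      exact MvPolynomial.mem_support_iff.mp hα (hF α (not_le.mp hlt))
    have he : m * α.degree = m * d + m * (α.degree - d) := by
      rw [← mul_add, Nat.add_sub_cancel' hle]
    rw [prod_pow_mul_pow, he, pow_add, ← C_eq_algebraMap]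
    ring
  obtain ⟨s, rfl⟩ := Nat.exists_eq_add_of_lt hr
  rw [h1, show m * d + s + 1 = m * d + (s + 1) by ring, pow_add,
    mul_dvd_mul_iff_left (pow_ne_zero _ X_ne_zero)] at h
  have h2 := (dvd_pow_self X s.succ_ne_zero).trans h
  rw [X_dvd_iff, coeff_zero_eq_eval_zero, eval_finsetSum] at h2
  rw [MvPolynomial.homogeneousComponent_apply, map_sum, Finset.sum_filter]
  refine Eq.trans ?_ h2
  refine Finset.sum_congr rfl fun α hα => ?_
  have hle : d ≤ α.degree := by
    by_contra hlt
    exact MvPolynomial.mem_support_iff.mp hα (hF α (not_le.mp hlt))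
  simp only [eval_mul, eval_C, eval_pow, eval_X, eval_prod]
  split_ifs with hd
  · simp [hd, MvPolynomial.eval_monomial, Finsupp.prod_fintype]
  · have : m * (α.degree - d) ≠ 0 := by
      have : 0 < α.degree - d := by omega
      positivity
    simp [this]

end MvPolynomialLemmas

/-! ### The double zero modulo `ϖ`, and valuations read off from polynomials modulo `ϖ`. -/

namespace IsUniformizingGenerator

variable {A B k : Type*} [CommRing A] [CommRing B] [Algebra A B] [Field k]
    {ϖ : A} {ϕ : A →+* k} {π : B} {e : ℕ} {E : Polynomial A}

open Polynomial

/-- If the differentials of the coordinates vanish and all partial derivatives of `f` vanish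
modulo `ϖ`, then a zero of `f` is a double zero modulo `ϖ`. -/
theorem X_pow_two_mul_dvd [IsDomain B] (H : IsUniformizingGenerator ϖ ϕ π e E) (hϖ : ϕ ϖ = 0)
    {σ : Type*} [Fintype σ] {f : MvPolynomial σ A} (hf : ∀ j α, ϖ ∣ (α j : A) * f.coeff α)
    {h : σ → A[X]} (hh : ∀ j, aeval π (derivative E) ∣ aeval π (derivative (h j))) {M : ℕ}
    (hM : aeval π (derivative E) ∣ algebraMap A B ϖ ^ M)
    (hz : algebraMap A B ϖ ^ (M + 1) ∣ MvPolynomial.aeval (fun j => aeval π (h j)) f) :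
    X ^ (2 * e) ∣ (MvPolynomial.aeval h f).map ϕ := by
  obtain ⟨z, hz⟩ := hz
  obtain ⟨c, rfl⟩ := H.surjective z
  have hcomp : ∀ q : MvPolynomial σ A, aeval π (MvPolynomial.aeval h q) =
      MvPolynomial.aeval (fun j => aeval π (h j)) q := fun q => by
    rw [← MvPolynomial.comp_aeval_apply]
  -- This polynomial vanishes at `π`, so it is `E q`. Its derivative at `π` is `E'(π) q(π)`, which
  -- gives access to `q(π)`.
  obtain ⟨q, hq⟩ := H.dvd (MvPolynomial.aeval h f - C ϖ ^ (M + 1) * c) (by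
    rw [map_sub, hcomp, hz, map_mul, map_pow, aeval_C, sub_self])
  have hr : ∀ j, ∃ r, MvPolynomial.pderiv j f = MvPolynomial.C ϖ * r := fun j => by
    refine (MvPolynomial.C_dvd_iff_dvd_coeff _ _).mpr fun α => ?_
    rw [MvPolynomial.coeff_pderiv, mul_comm]
    have := hf j (α + Finsupp.single j 1)
    rwa [Finsupp.add_apply, Finsupp.single_eq_same, Nat.cast_add, Nat.cast_one] at this
  choose r hr using hr
  choose v hv using hh
  obtain ⟨s, hs⟩ := hM
  have hder := congrArg (fun w => aeval π (derivative w)) hq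
  have hC : derivative (C ϖ ^ (M + 1)) = 0 := by rw [← C_pow, derivative_C]
  have hCa : aeval π (algebraMap A A[X] ϖ) = algebraMap A B ϖ := aeval_C π ϖ
  rw [derivative_sub] at hder
  simp only [derivative_mul, Polynomial.derivative_mvPolynomial_aeval, hr,
    map_sub, map_add, map_mul, map_sum, H.aeval_eq_zero, zero_mul, add_zero, hv, hcomp,
    MvPolynomial.aeval_C, hC, hCa, zero_add, aeval_C, map_pow] at hder
  have hE := H.aeval_derivative_ne_zero
  -- Cancel `E'(π)`: it divides each `h_j'(π)` and also `ϖ^M`, so one factor `ϖ` survives from the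
  -- partial derivatives and one from `ϖ^(M+1)`.
  have hqπ : aeval π q = algebraMap A B ϖ *
      (∑ j, MvPolynomial.aeval (fun j => aeval π (h j)) (r j) * v j -
        s * aeval π (derivative c)) := by
    apply mul_left_cancel₀ hE
    rw [← hder, pow_succ, hs]
    simp only [mul_sub, Finset.mul_sum]
    congr 1
    · exact Finset.sum_congr rfl fun j _ => by ring
    · ring
  obtain ⟨w, hw⟩ := H.surjective (∑ j, MvPolynomial.aeval (fun j => aeval π (h j)) (r j) * v j -
        s * aeval π (derivative c))
  obtain ⟨b, hb⟩ := H.dvd (q - C ϖ * w) (by rw [map_sub, hqπ, map_mul, hw, aeval_C, sub_self])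
  refine ⟨b.map ϕ, ?_⟩
  have : MvPolynomial.aeval h f = C ϖ ^ (M + 1) * c + E * (C ϖ * w + E * b) := by
    linear_combination hq + E * hb
  rw [this]
  simp only [Polynomial.map_add, Polynomial.map_mul, Polynomial.map_pow, map_C, hϖ, H.map_eq,
    C_0]
  ring

/-- Up to order `e` the `π`-adic valuation of `h(π)` is the `X`-adic one of `h` mod `ϖ`: the
ambiguity is a multiple of `E`, which reduces to `X^e`. The converse `pow_dvd_aeval` holds because
`ϖ` is associated to `π^e`. -/
theorem X_pow_dvd_map (H : IsUniformizingGenerator ϖ ϕ π e E) {m : ℕ} (hm : m ≤ e) {h : A[X]}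
    (hh : π ^ m ∣ aeval π h) : X ^ m ∣ h.map ϕ := by
  obtain ⟨y, hy⟩ := hh
  obtain ⟨y, rfl⟩ := H.surjective y
  obtain ⟨q, hq⟩ := H.dvd (h - X ^ m * y) (by simp [hy])
  rw [sub_eq_iff_eq_add] at hq
  rw [hq, Polynomial.map_add, Polynomial.map_mul, Polynomial.map_mul, H.map_eq,
    Polynomial.map_pow, map_X]
  exact dvd_add ((pow_dvd_pow _ hm).mul_right _) (dvd_mul_right _ _)

theorem pow_dvd_aeval (H : IsUniformizingGenerator ϖ ϕ π e E) (hϕ : Function.Surjective ϕ)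
    (hker : RingHom.ker ϕ = Ideal.span {ϖ}) {m : ℕ} (hm : m ≤ e) {h : A[X]}
    (hh : X ^ m ∣ h.map ϕ) : π ^ m ∣ aeval π h := by
  obtain ⟨r', hr⟩ := hh
  obtain ⟨r, rfl⟩ := map_surjective ϕ hϕ r'
  obtain ⟨s, hs⟩ : C ϖ ∣ h - X ^ m * r := by
    refine (C_dvd_iff_dvd_coeff _ _).mpr fun i => ?_
    rw [← Ideal.mem_span_singleton, ← hker, RingHom.mem_ker, ← coeff_map]
    simp [hr]
  rw [sub_eq_iff_eq_add] at hs
  rw [hs, map_add, map_mul, map_mul, map_pow, aeval_X, aeval_C]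
  exact dvd_add (((pow_dvd_pow _ hm).trans H.associated_algebraMap.symm.dvd).mul_right _)
    (dvd_mul_right _ _)

theorem exists_dvd_pow (H : IsUniformizingGenerator ϖ ϕ π e E) {x : B} (hx : x ≠ 0) :
    ∃ M : ℕ, x ∣ algebraMap A B ϖ ^ M := by
  obtain ⟨n, hn⟩ := H.associated x hx
  refine ⟨n, hn.dvd.trans ?_⟩
  refine (pow_dvd_pow_of_dvd ?_ n)
  exact (dvd_pow_self π H.pos.ne').trans H.associated_algebraMap.symm.dvd

end IsUniformizingGenerator

/-! ### The valuation bound and the contradiction for a strict truncation. -/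

/-- The properties of sufficiently long truncations of the multiplication by `ϖ` of a strict
formal group law: `ϕ` is the residue map and `d` the common degree of the lowest forms. -/
structure IsStrictTruncation {A k σ : Type*} [CommRing A] [Field k] [DecidableEq σ] (ϖ : A)
    (ϕ : A →+* k) (d : ℕ) (f : σ → MvPolynomial σ A) : Prop where
  dvd_mul_coeff : ∀ i j α, ϖ ∣ (α j : A) * (f i).coeff α
  coeff_zero : ∀ i, (f i).coeff 0 = 0
  coeff_single : ∀ i j, (f i).coeff (Finsupp.single j 1) = if i = j then ϖ else 0
  dvd_coeff : ∀ i α, α.degree < d → ϖ ∣ (f i).coeff α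
  eq_zero : ∀ a : σ → k,
    (∀ i, MvPolynomial.eval a (MvPolynomial.homogeneousComponent d ((f i).map ϕ)) = 0) → a = 0

namespace IsStrictTruncation

variable {A B k σ : Type*} [CommRing A] [CommRing B] [IsDomain B] [Algebra A B] [Field k]
  [Fintype σ] [DecidableEq σ] {ϖ : A} {ϕ : A →+* k} {π : B} {e : ℕ} {E : Polynomial A}

/-- Otherwise `ϖ x_i`, of valuation `e + m`, is the only term of `f_i(x)` not divisible by
`π^(e+m+1)`. Terms of degree between `2` and `d - 1` carry a factor `ϖ` and have valuation at least
`e + 2m`; those of degree at least `d` have valuation at least `md ≥ e + m + 1`. -/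
theorem mul_sub_one_le {d : ℕ} {f : σ → MvPolynomial σ A}
    (hf : IsStrictTruncation ϖ ϕ d f) (H : IsUniformizingGenerator ϖ ϕ π e E) {m : ℕ} (hm : 0 < m)
    (hd : 1 ≤ d)
    {x : σ → B} (hx : ∀ j, π ^ m ∣ x j) (hx' : ∃ i, ¬ π ^ (m + 1) ∣ x i)
    {N : ℕ} (hN : m + 2 ≤ N) (hfx : ∀ i, algebraMap A B ϖ ^ N ∣ MvPolynomial.aeval x (f i)) :
    m * (d - 1) ≤ e := by
  by_contra! hlt
  obtain ⟨i, hi⟩ := hx'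
  apply hi
  have hmd : e + m + 1 ≤ m * d := by
    obtain ⟨d, rfl⟩ := Nat.exists_eq_add_of_le' hd
    rw [Nat.add_sub_cancel] at hlt
    rw [mul_add, mul_one]
    omega
  have hϖ := H.associated_algebraMap
  choose y hy using hx
  have hterm : ∀ α : σ →₀ ℕ, α ≠ Finsupp.single i 1 →
      π ^ (e + m + 1) ∣ algebraMap A B ((f i).coeff α) * ∏ j, x j ^ α j := by
    intro α hα
    simp only [hy, prod_pow_mul_pow]
    rcases lt_or_ge α.degree d with hlt | hge
    · rcases Nat.lt_or_ge α.degree 2 with h2 | h2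
      · have : (f i).coeff α = 0 := by
          rcases Nat.lt_or_ge α.degree 1 with h1 | h1
          · have : α = 0 := by
              rw [← Finsupp.degree_eq_zero_iff]
              omega
            rw [this, hf.coeff_zero]
          · obtain ⟨j, rfl⟩ := α.exists_eq_single_of_degree_eq_one (by omega)
            rw [hf.coeff_single, if_neg]
            rintro rfl
            exact hα rfl
        simp [this]
      · obtain ⟨c, hc⟩ := hf.dvd_coeff i α hlt
        rw [hc, map_mul, mul_assoc, mul_left_comm (algebraMap A B c), ← mul_assoc]
        refine Dvd.dvd.mul_right ?_ _
        have h3 : e + m + 1 ≤ e + m * α.degree := by nlinarith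
        refine (pow_dvd_pow π h3).trans ?_
        rw [pow_add]
        exact mul_dvd_mul hϖ.symm.dvd dvd_rfl
    · refine ((pow_dvd_pow π (hmd.trans (Nat.mul_le_mul_left m hge))).mul_right _).mul_left _
  have hsum : π ^ (e + m + 1) ∣ MvPolynomial.aeval x (f i) - algebraMap A B ϖ * x i := by
    have : MvPolynomial.aeval x (f i) - algebraMap A B ϖ * x i =
        ∑ α ∈ ((f i).support ∪ {Finsupp.single i 1}).erase (Finsupp.single i 1),
          algebraMap A B ((f i).coeff α) * ∏ j, x j ^ α j := by
      rw [Finset.sum_erase_eq_sub (by simp), MvPolynomial.aeval_def, MvPolynomial.eval₂_eq']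
      congr 1
      · refine Finset.sum_subset Finset.subset_union_left fun α _ hα => ?_
        rw [MvPolynomial.notMem_support_iff.mp hα, map_zero, zero_mul]
      · rw [hf.coeff_single, if_pos rfl, Finset.prod_eq_single i]
        · simp
        · intro j _ hj
          simp [Finsupp.single_eq_of_ne hj]
        · simp
    rw [this]
    exact Finset.dvd_sum fun α hα => hterm α (Finset.ne_of_mem_erase hα)
  have hbig : π ^ (e + m + 1) ∣ MvPolynomial.aeval x (f i) := by
    refine Dvd.dvd.trans ?_ (hfx i)
    -- Here `m + 2 ≤ N` is used: `e(m + 2) ≥ e + m + 1` because `e ≥ 1`.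
    have h1 : e + m + 1 ≤ e * N := by
      have := H.pos
      calc e + m + 1 ≤ e * (m + 2) := by nlinarith
        _ ≤ e * N := Nat.mul_le_mul_left _ hN
    refine (pow_dvd_pow π h1).trans ?_
    rw [pow_mul]
    exact pow_dvd_pow_of_dvd hϖ.symm.dvd N
  have h4 : π ^ (e + m + 1) ∣ algebraMap A B ϖ * x i := by
    have := dvd_sub hbig hsum
    rwa [sub_sub_cancel] at this
  have h5 : π ^ e * π ^ (m + 1) ∣ π ^ e * x i := by
    rw [← pow_add, ← add_assoc]
    exact h4.trans (mul_dvd_mul hϖ.dvd dvd_rfl)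
  exact (mul_dvd_mul_iff_left (pow_ne_zero _ H.prime.ne_zero)).mp h5

end IsStrictTruncation

open Polynomial in
/-- A point all of whose coordinates have vanishing differential is not a non-trivial torsion
point. -/
theorem eq_zero_of_isStrictTruncation {A B k σ : Type*} [CommRing A] [CommRing B] [IsDomain B]
    [Algebra A B] [Field k] [Fintype σ] [DecidableEq σ] {ϖ : A} {ϕ : A →+* k} {π : B} {e : ℕ}
    {E : A[X]} (H : IsUniformizingGenerator ϖ ϕ π e E) (hϕ : Function.Surjective ϕ)
    (hker : RingHom.ker ϕ = Ideal.span {ϖ}) {d : ℕ} (hd : 3 ≤ d) {x : σ → B}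
    (hxπ : ∀ j, π ∣ x j) (hD : ∀ j, KaehlerDifferential.D A B (x j) = 0)
    (hf : ∀ N : ℕ, ∃ f : σ → MvPolynomial σ A, IsStrictTruncation ϖ ϕ d f ∧
      ∀ i, algebraMap A B ϖ ^ N ∣ MvPolynomial.aeval x (f i)) : x = 0 := by
  by_contra hx0
  have hϖ0 : ϕ ϖ = 0 := by
    rw [← RingHom.mem_ker, hker]
    exact Ideal.mem_span_singleton_self _
  obtain ⟨m, hm, hxm, hxm'⟩ : ∃ m, 0 < m ∧ (∀ j, π ^ m ∣ x j) ∧ ∃ i, ¬ π ^ (m + 1) ∣ x i := by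
    obtain ⟨i, hi⟩ := Function.ne_iff.mp hx0
    obtain ⟨n, hn⟩ := H.associated (x i) hi
    have hex : ∃ m, ∃ i, ¬ π ^ (m + 1) ∣ x i := by
      refine ⟨n, i, fun h => ?_⟩
      have := (pow_dvd_pow_iff H.prime.ne_zero H.prime.not_isUnit).mp (h.trans hn.dvd)
      omega
    classical
    have hmin := fun {j} => Nat.find_min hex (m := j)
    have hspec := Nat.find_spec hex
    generalize Nat.find hex = m at hmin hspec
    have hm : 0 < m := by
      rw [pos_iff_ne_zero]
      rintro rfl
      obtain ⟨i, hi⟩ := hspec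
      exact hi (by simpa using hxπ i)
    refine ⟨m, hm, fun j => ?_, hspec⟩
    by_contra hj
    refine hmin (j := m - 1) (Nat.sub_lt hm one_pos) ⟨j, ?_⟩
    rwa [show m - 1 + 1 = m from Nat.sub_add_cancel hm]
  obtain ⟨M, hM⟩ := H.exists_dvd_pow H.aeval_derivative_ne_zero
  -- Precision `M + 1` serves the double zero, and `m + 2` the valuation bound.
  obtain ⟨f, hfs, hfx⟩ := hf (M + 1 + (m + 2))
  have hle := hfs.mul_sub_one_le H hm (by omega) hxm hxm' (Nat.le_add_left _ _) hfx
  have hme : m + 1 ≤ e := by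
    have : m * 2 ≤ m * (d - 1) := Nat.mul_le_mul_left m (by omega)
    omega
  have hmd : m * d < 2 * e := by
    obtain ⟨d, rfl⟩ := Nat.exists_eq_add_of_le' hd
    have : d + 3 - 1 = d + 2 := rfl
    rw [this] at hle
    nlinarith
  choose h hh using fun j => H.surjective (x j)
  have hxh : x = fun j => aeval π (h j) := funext fun j => (hh j).symm
  have hu : ∀ j, X ^ m ∣ (h j).map ϕ := fun j =>
    H.X_pow_dvd_map (by omega) (by rw [hh]; exact hxm j)
  choose u hu using hu
  -- As `md < 2e`, divisibility by `X^(2e)` kills the lowest form at `u(0)`, and strictness applies.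
  have hzero : (fun j => (u j).eval 0) = 0 := by
    refine hfs.eq_zero _ fun i => ?_
    refine eval_homogeneousComponent_eq_zero (r := 2 * e) hm hmd (fun α hα => ?_) u ?_
    · obtain ⟨c, hc⟩ := hfs.dvd_coeff i α hα
      rw [MvPolynomial.coeff_map, hc, map_mul, hϖ0, zero_mul]
    · have h1 := H.X_pow_two_mul_dvd hϖ0 (hfs.dvd_mul_coeff i) (h := h) (M := M)
        (fun j => KaehlerDifferential.aeval_derivative_dvd_of_D_eq_zero H.surjective H.dvd
          H.aeval_eq_zero (by rw [hh]; exact hD j)) hM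
        (by
          rw [← hxh]
          exact (pow_dvd_pow _ (Nat.le_add_right _ _)).trans (hfx i))
      have h2 : (MvPolynomial.aeval h (f i)).map ϕ =
          MvPolynomial.aeval (fun j => X ^ m * u j) ((f i).map ϕ) := by
        simp only [← hu]
        rw [← coe_mapRingHom, MvPolynomial.map_aeval, MvPolynomial.aeval_def,
          MvPolynomial.eval₂_map]
        have hC : (mapRingHom ϕ).comp (algebraMap A A[X]) = (algebraMap k k[X]).comp ϕ := by
          ext a
          simp
        rw [← hC]
        rfl
      rwa [h2] at h1
  obtain ⟨i, hi⟩ := hxm'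
  apply hi
  rw [← hh i]
  refine H.pow_dvd_aeval hϕ hker hme ?_
  have : X ∣ u i := by
    rw [X_dvd_iff, coeff_zero_eq_eval_zero]
    exact congrFun hzero i
  rw [hu, pow_succ]
  exact mul_dvd_mul dvd_rfl this

/-! ### Truncations of `[p]` over the Witt vectors. -/

namespace MvPowerSeries

/-- The polynomial formed by the monomials of a power series in a finite set. -/
def restrictMonomials {σ R : Type*} [CommSemiring R] (f : MvPowerSeries σ R)
    (t : Finset (σ →₀ ℕ)) : MvPolynomial σ R :=
  ∑ m ∈ t, MvPolynomial.monomial m (coeff m f)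

theorem coeff_restrictMonomials {σ R : Type*} [CommSemiring R] [DecidableEq σ]
    (f : MvPowerSeries σ R) (t : Finset (σ →₀ ℕ)) (m : σ →₀ ℕ) :
    (f.restrictMonomials t).coeff m = if m ∈ t then coeff m f else 0 := by
  simp [restrictMonomials, MvPolynomial.coeff_sum, MvPolynomial.coeff_monomial]

theorem aeval_restrictMonomials {σ R A : Type*} [Fintype σ] [CommSemiring R] [CommSemiring A]
    [Algebra R A] (f : MvPowerSeries σ R) (t : Finset (σ →₀ ℕ)) (x : σ → A) :
    MvPolynomial.aeval x (f.restrictMonomials t) =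
      ∑ m ∈ t, algebraMap R A (coeff m f) * ∏ i, x i ^ m i := by
  rw [restrictMonomials, map_sum]
  refine Finset.sum_congr rfl fun m _ => ?_
  rw [MvPolynomial.aeval_monomial, Finsupp.prod_fintype _ _ fun i => pow_zero _]

end MvPowerSeries

theorem coeff_unitForm {R : Type*} [CommRing R] {g : ℕ} (f : MvPowerSeries (Fin g) R)
    (m : Fin g →₀ ℕ) [Decidable (m.degree = unitDegree f ∧ IsUnit (MvPowerSeries.coeff m f))] :
    (unitForm f).coeff m = if m.degree = unitDegree f ∧ IsUnit (MvPowerSeries.coeff m f) then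
      MvPowerSeries.coeff m f else 0 := by
  classical
  simp [unitForm, MvPolynomial.coeff_sum, MvPolynomial.coeff_monomial, Finset.mem_filter,
    Finset.mem_finsuppAntidiag, Finsupp.degree_eq_sum]

theorem WittVector.constantCoeff_eq_zero_of_not_isUnit {p : ℕ} [Fact p.Prime] {x : OK p}
    (hx : ¬ IsUnit x) : WittVector.constantCoeff x = 0 := by
  by_contra h
  exact hx (WittVector.isUnit_of_coeff_zero_ne_zero x h)

theorem WittVector.dvd_of_not_isUnit {p : ℕ} [Fact p.Prime] {x : OK p}
    (hx : ¬ IsUnit x) : (p : OK p) ∣ x := by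
  rw [← Ideal.mem_span_singleton, ← WittVector.ker_constantCoeff]
  exact WittVector.constantCoeff_eq_zero_of_not_isUnit hx

/-- A nonzero characteristic would be a prime divisible by the residue characteristic `p`, hence `p`
itself; but `p` is irreducible in the Witt vectors, so nonzero. -/
theorem WittVector.charZero_OK (p : ℕ) [Fact p.Prime] : CharZero (OK p) := by
  obtain ⟨q, hq⟩ := CharP.exists (OK p)
  have h0 : q = 0 := by
    by_contra hq0
    have hpq : p ∣ q := by
      rw [← CharP.cast_eq_zero_iff (FpBar p) p,
        ← map_natCast (WittVector.constantCoeff : OK p →+* FpBar p), CharP.cast_eq_zero, map_zero]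
    have hprime : q.Prime := (CharP.char_is_prime_or_zero (OK p) q).resolve_right hq0
    have : q = p := ((Nat.prime_dvd_prime_iff_eq Fact.out hprime).mp hpq).symm
    subst this
    exact (WittVector.irreducible (k := FpBar q) q).ne_zero (CharP.cast_eq_zero (OK q) q)
  subst h0
  exact CharP.charP_to_charZero _

namespace FormalGroupLaw

variable {p : ℕ} [Fact p.Prime] {g : ℕ} {F : FormalGroupLaw (OK p) g}

/-- The exponents of a monomial with unit coefficient in `[p]` are divisible by `p`. -/
theorem dvd_of_isUnit_coeff_mulBy {i : Fin g} {m : Fin g →₀ ℕ}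
    (hm : IsUnit (MvPowerSeries.coeff m (F.mulBy p i))) (j : Fin g) : p ∣ m j := by
  have h := F.dvd_mul_coeff_mulBy p i j m
  rw [hm.dvd_mul_right] at h
  have h2 : WittVector.constantCoeff ((m j : ℕ) : OK p) = 0 := by
    rw [← RingHom.mem_ker, WittVector.ker_constantCoeff]
    exact Ideal.mem_span_singleton.mpr h
  rw [map_natCast] at h2
  exact (CharP.cast_eq_zero_iff (FpBar p) p _).mp h2

theorem le_degree_of_isUnit_coeff_mulBy {i : Fin g} {m : Fin g →₀ ℕ}
    (hm : IsUnit (MvPowerSeries.coeff m (F.mulBy p i))) : p ≤ m.degree := by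
  have h0 : m ≠ 0 := by
    rintro rfl
    rw [MvPowerSeries.coeff_zero_eq_constantCoeff_apply, F.constantCoeff_mulBy] at hm
    exact not_isUnit_zero hm
  obtain ⟨j, hj⟩ := Finsupp.ne_iff.mp h0
  exact (Nat.le_of_dvd (Nat.pos_of_ne_zero hj) (dvd_of_isUnit_coeff_mulBy hm j)).trans
    (Finsupp.le_degree j m)

/-- The common degree of the lowest forms of a strict formal group law is at least `p`. -/
theorem IsStrict.le_unitDegree (hF : F.IsStrict) (i : Fin g) : p ≤ unitDegree (F.mulBy p i) := by
  -- Without unit coefficients all lowest forms are zero and `(1, …, 1)` is a common zero. A single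
  -- component with a unit coefficient is enough, since the degrees agree; this also excludes the
  -- default degree `0` elsewhere.
  have hex : ∃ i m, IsUnit (MvPowerSeries.coeff m (F.mulBy p i)) := by
    by_contra! hno
    have h1 : (1 : Fin g → FpBar p) = 0 := hF.2 1 fun i => by
      have : unitForm (F.mulBy p i) = 0 := by
        classical
        ext m
        simp [coeff_unitForm, hno]
      simp [this]
    exact one_ne_zero (congrFun h1 i)
  obtain ⟨j, m, hm⟩ := hex
  have hne : {d | ∃ m : Fin g →₀ ℕ, m.degree = d ∧
      IsUnit (MvPowerSeries.coeff m (F.mulBy p j))}.Nonempty := ⟨_, m, rfl, hm⟩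
  obtain ⟨m', hm', hu⟩ := Nat.sInf_mem hne
  rw [hF.1 i j]
  exact (le_degree_of_isUnit_coeff_mulBy hu).trans_eq hm'

/-- Long truncations of `[p]`. -/
theorem IsStrict.isStrictTruncation (hF : F.IsStrict) {d : ℕ} (hd : 1 ≤ d)
    (hdeg : ∀ i, unitDegree (F.mulBy p i) = d) {t : Fin g → Finset (Fin g →₀ ℕ)}
    (ht : ∀ i m, m.degree ≤ d → m ∈ t i) :
    IsStrictTruncation (p : OK p) (WittVector.constantCoeff : OK p →+* FpBar p) d
      (fun i => (F.mulBy p i).restrictMonomials (t i)) where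
  dvd_mul_coeff i j α := by
    rw [MvPowerSeries.coeff_restrictMonomials]
    split_ifs
    · exact F.dvd_mul_coeff_mulBy p i j α
    · simp
  coeff_zero i := by
    rw [MvPowerSeries.coeff_restrictMonomials, MvPowerSeries.coeff_zero_eq_constantCoeff_apply,
      F.constantCoeff_mulBy, ite_self]
  coeff_single i j := by
    rw [MvPowerSeries.coeff_restrictMonomials, if_pos (ht _ _ (by simpa using hd)),
      F.coeff_single_mulBy]
  dvd_coeff i α hα := by
    rw [MvPowerSeries.coeff_restrictMonomials]
    split_ifs
    · refine WittVector.dvd_of_not_isUnit fun hu => ?_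
      rw [← hdeg i] at hα
      exact Nat.notMem_of_lt_sInf hα ⟨α, rfl, hu⟩
    · exact dvd_zero _
  eq_zero a ha := by
    refine hF.2 a fun i => ?_
    -- In degree `d` the truncation keeps every monomial, and reduction kills exactly those with
    -- non-unit coefficient.
    have : MvPolynomial.map (WittVector.constantCoeff : OK p →+* FpBar p)
        (unitForm (F.mulBy p i)) = MvPolynomial.homogeneousComponent d
          (((F.mulBy p i).restrictMonomials (t i)).map WittVector.constantCoeff) := by
      classical
      ext α
      rw [MvPolynomial.coeff_map, coeff_unitForm, MvPolynomial.coeff_homogeneousComponent,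
        MvPolynomial.coeff_map, MvPowerSeries.coeff_restrictMonomials, hdeg i]
      by_cases hα : α.degree = d
      · rw [if_pos hα, if_pos (ht _ _ hα.le)]
        split_ifs with hu
        · rfl
        · rw [map_zero, WittVector.constantCoeff_eq_zero_of_not_isUnit fun h => hu ⟨hα, h⟩]
      · rw [if_neg hα, if_neg fun h => hα h.1, map_zero]
    rw [this]
    exact ha i

end FormalGroupLaw

/-! ### Descent to a finite extension of `K`, and the theorem. -/

theorem KaehlerDifferential.exists_finite_of_forall_D_eq_zero (R : Type*) {S ι : Type*}
    [CommRing R] [CommRing S] [Algebra R S] [Finite ι] {x : ι → S} (hx : ∀ i, D R S (x i) = 0) :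
    ∃ Y : Set S, Y.Finite ∧ ∀ (B : Type*) [CommRing B] [Algebra R B] (φ : B →ₐ[R] S),
      Function.Injective φ → Y ⊆ Set.range φ → ∀ i x', φ x' = x i → D R B x' = 0 := by
  choose Y hY h using fun i => exists_finite_of_D_eq_zero R (hx i)
  refine ⟨⋃ i, Y i, Set.finite_iUnion hY, fun B _ _ φ hφ hYφ i => ?_⟩
  exact h i B φ hφ ((Set.subset_iUnion Y i).trans hYφ)

/-- A finite set of integral elements lies in the ring of integers of a finite extension. -/
theorem exists_intermediateField_subset_range {A K Ω : Type*} [CommRing A] [Field K] [Field Ω]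
    [Algebra A K] [Algebra K Ω] [Algebra A Ω] [IsScalarTower A K Ω] [Algebra.IsAlgebraic K Ω]
    {Y : Set (integralClosure A Ω)} (hY : Y.Finite) :
    ∃ (L : IntermediateField K Ω), FiniteDimensional K L ∧
      Y ⊆ Set.range ((L.val.restrictScalars A).mapIntegralClosure) := by
  have hfin := hY.image (Subtype.val : integralClosure A Ω → Ω)
  have : Finite ↑((Subtype.val : integralClosure A Ω → Ω) '' Y) := hfin
  refine ⟨IntermediateField.adjoin K ((Subtype.val : integralClosure A Ω → Ω) '' Y),
    IntermediateField.finiteDimensional_adjoin fun x _ =>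
      Algebra.IsIntegral.isIntegral x, fun y hy => ?_⟩
  have hyL := IntermediateField.subset_adjoin K _ (Set.mem_image_of_mem Subtype.val hy)
  have hint : IsIntegral A (⟨y, hyL⟩ : IntermediateField.adjoin K
      ((Subtype.val : integralClosure A Ω → Ω) '' Y)) :=
    (isIntegral_algHom_iff ((IntermediateField.val _).restrictScalars A)
      Subtype.val_injective).mp y.2
  exact ⟨⟨_, hint⟩, Subtype.ext rfl⟩

/-- Divisibility by an element of the base descends along integrally closed subrings. -/
theorem algebraMap_dvd_of_mapIntegralClosure {A L Ω : Type*} [CommRing A] [Field L] [Field Ω]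
    [Algebra A L] [Algebra A Ω] (φ : L →ₐ[A] Ω) {a : A} (ha : algebraMap A L a ≠ 0)
    {x : integralClosure A L}
    (h : algebraMap A (integralClosure A Ω) a ∣ φ.mapIntegralClosure x) :
    algebraMap A (integralClosure A L) a ∣ x := by
  obtain ⟨z, hz⟩ := h
  have hz' : φ x = algebraMap A Ω a * z := congrArg Subtype.val hz
  have hφ : φ (x / algebraMap A L a) = z := by
    rw [map_div₀, hz', AlgHom.commutes, mul_div_cancel_left₀]
    rw [← φ.commutes]
    exact (map_ne_zero φ).mpr ha
  have hint : IsIntegral A ((x : L) / algebraMap A L a) :=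
    (isIntegral_algHom_iff φ φ.injective).mp (hφ ▸ z.2)
  refine ⟨⟨_, hint⟩, Subtype.ext ?_⟩
  change (x : L) = algebraMap A L a * (x / algebraMap A L a)
  rw [mul_div_cancel₀ _ ha]

theorem algebraMap_injective_of_isFractionRing (A K L : Type*) [CommRing A] [Field K] [Field L]
    [Algebra A K] [IsFractionRing A K] [Algebra K L] [Algebra A L] [IsScalarTower A K L] :
    Function.Injective (algebraMap A L) := by
  rw [IsScalarTower.algebraMap_eq A K L]
  exact (algebraMap K L).injective.comp (IsFractionRing.injective A K)

theorem exists_isUniformizingGenerator_integralClosure {A K L k : Type*} [CommRing A] [IsDomain A]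
    [IsDiscreteValuationRing A] [CharZero A] [Field K] [Field L] [Algebra A K] [IsFractionRing A K]
    [Algebra K L] [Algebra A L] [IsScalarTower A K L] [FiniteDimensional K L] [Field k]
    [IsAlgClosed k] {ϖ : A} {ϕ : A →+* k}
    (hϖ : Irreducible ϖ) (hϕ : Function.Surjective ϕ)
    (hker : RingHom.ker ϕ = Ideal.span {ϖ}) [IsAdicComplete (Ideal.span {ϖ}) A] :
    ∃ (π : integralClosure A L) (e : ℕ) (E : Polynomial A), IsUniformizingGenerator ϖ ϕ π e E := by
  have : CharZero K := charZero_of_injective_algebraMap (IsFractionRing.injective A K)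
  have : Module.IsTorsionFree A L := by
    rw [Module.isTorsionFree_iff_algebraMap_injective]
    exact algebraMap_injective_of_isFractionRing A K L
  have : IsDedekindDomain (integralClosure A L) := integralClosure.isDedekindDomain A K L
  have : Module.Finite A (integralClosure A L) :=
    IsIntegralClosure.finite A K L (integralClosure A L)
  have : Module.IsTorsionFree A (integralClosure A L) := IsIntegralClosure.isTorsionFree A L
  exact exists_isUniformizingGenerator hϖ hϕ hker

theorem AlgHom.mapIntegralClosure_injective {A L Ω : Type*} [CommRing A] [Field L] [Field Ω]
    [Algebra A L] [Algebra A Ω] (φ : L →ₐ[A] Ω) : Function.Injective φ.mapIntegralClosure := by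
  intro a b hab
  exact Subtype.ext (φ.injective (congrArg Subtype.val hab))

end

theorem mainTheorem3 (p : ℕ) [Fact p.Prime] (hp : 2 < p) (g : ℕ)
    (F : FormalGroupLaw (OK p) g) (hF : F.IsStrict)
    (P : Fin g → OBar p) (hP : P ∈ F.torsion p) (hP0 : P ≠ 0) :
    ∃ i, P i ∉ OOne p := by
  by_contra! hall
  obtain ⟨hPm, hPt⟩ := hP
  obtain ⟨i₀, -⟩ := Function.ne_iff.mp hP0
  have hD : ∀ i, KaehlerDifferential.D (OK p) (OBar p) (P i) = 0 := hall
  obtain ⟨Y, hY, hYD⟩ := KaehlerDifferential.exists_finite_of_forall_D_eq_zero (OK p) hD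
  -- `L` is chosen to contain both the coordinates of `P` and the elements needed to witness that
  -- their differentials vanish.
  obtain ⟨L, hL, hYL⟩ := exists_intermediateField_subset_range (A := OK p) (K := KField p)
    (hY.union (Set.finite_range P))
  have : CharZero (OK p) := WittVector.charZero_OK p
  let φ := L.val.restrictScalars (OK p)
  let B := integralClosure (OK p) L
  obtain ⟨π, e, E, H⟩ := exists_isUniformizingGenerator_integralClosure (A := OK p)
    (K := KField p) (L := L) (k := FpBar p) (ϖ := (p : OK p))
    (WittVector.irreducible p) (WittVector.constantCoeff_surjective p)
    WittVector.ker_constantCoeff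
  choose x hx using fun i => hYL (Set.mem_union_right _ (Set.mem_range_self i))
  have hp0 : ∀ N : ℕ, algebraMap (OK p) L ((p : OK p) ^ N) ≠ 0 := fun N => by
    rw [map_pow]
    refine pow_ne_zero _ ?_
    rw [Ne, map_eq_zero_iff _ (algebraMap_injective_of_isFractionRing (OK p) (KField p) L)]
    exact (WittVector.irreducible p).ne_zero
  have hx0 : x = 0 := by
    refine eq_zero_of_isStrictTruncation H (WittVector.constantCoeff_surjective p)
      WittVector.ker_constantCoeff (d := unitDegree (F.mulBy p i₀))
      (le_trans hp (hF.le_unitDegree i₀)) (fun j => ?_) (fun j => ?_) fun N => ?_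
    · by_contra hj
      have hne : x j ≠ 0 := by
        intro h
        exact hj (h ▸ dvd_zero π)
      obtain ⟨n, hn⟩ := H.associated _ hne
      rcases n with _ | n
      · rw [pow_zero, associated_one_iff_isUnit] at hn
        refine hPm j ?_
        rw [← hx j]
        exact hn.map φ.mapIntegralClosure
      · exact hj ((dvd_pow_self π n.succ_ne_zero).trans hn.symm.dvd)
    · exact hYD B φ.mapIntegralClosure φ.mapIntegralClosure_injective
        (Set.subset_union_left.trans hYL) j (x j) (hx j)
    · choose s hs using fun i => hPt i N
      classical
      have hdfin : {m : Fin g →₀ ℕ | m.degree ≤ unitDegree (F.mulBy p i₀)}.Finite :=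
        Finsupp.finite_of_degree_le _
      -- Convergence allows the partial sum to be enlarged, so that it contains all monomials of
      -- degree at most `d` and still vanishes at `P` modulo `p^N`.
      let t : Fin g → Finset (Fin g →₀ ℕ) := fun i => s i ∪ hdfin.toFinset
      refine ⟨_, hF.isStrictTruncation (t := t)
        (le_trans (by omega) (hF.le_unitDegree i₀)) (fun i => hF.1 i i₀)
        (fun i m hm => Finset.mem_union_right _ (hdfin.mem_toFinset.mpr hm)), fun i => ?_⟩
      rw [← map_pow]
      refine algebraMap_dvd_of_mapIntegralClosure φ (hp0 N) ?_
      have h1 := hs i (t i) Finset.subset_union_left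
      rw [sub_zero, ← MvPowerSeries.aeval_restrictMonomials] at h1
      have h2 : φ.mapIntegralClosure
          (MvPolynomial.aeval x ((F.mulBy p i).restrictMonomials (t i))) =
          MvPolynomial.aeval P ((F.mulBy p i).restrictMonomials (t i)) := by
        rw [MvPolynomial.comp_aeval_apply]
        exact congrArg (fun y => MvPolynomial.aeval y _) (funext hx)
      rw [h2, map_pow, map_natCast]
      exact h1
  apply hP0
  funext i
  rw [← hx i, hx0]
  exact map_zero φ.mapIntegralClosure
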